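/- Let $p,q$ be prime numbers with $p\equiv 1 \bmod 4$ and $q\equiv 3 \bmod 4$, let $d=pq$, let $K=\mathbb{Q}(\sqrt d)\subseteq\mathbb{R}$ with ring of integers $\mathcal{O}_K$, and suppose that the class number $h(d)=|\mathrm{Pic}(\mathcal{O}_K)|$ equals $2$. Notation. Since $d\equiv 3\bmod 4$, we have $\mathcal{O}_K=\mathbb{Z}[\sqrt d]$, and $K$ has discriminant $\mathsf{d}_K=4d$. Let $\varepsilon>1$ be the fundamental unit of $\mathcal{O}_K$ (that is, $\varepsilon\in\mathcal{O}_K^{\times}$, $\varepsilon>1$ and $\mathcal{O}_K^\times=\{\pm\varepsilon^k:k\in\mathbb{Z}\}$), and write $\varepsilon=x+y\sqrt d$ with integers $x,y\ge 0$. For a positive integer $f$, let $\mathcal{O}_f=\mathbb{Z}+f\mathcal{O}_K$ be the order of conductor $f$ in $K$, with Picard group $\mathrm{Pic}(\mathcal{O}_f)$. Let $\left(\frac{a}{r}\right)$ denote the Kronecker symbol; a prime $r$ is called ramified if $\left(\frac{\mathsf{d}_K}{r}\right)=0$ and split if $\left(\frac{\mathsf{d}_K}{r}\right)=1$. A positive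 integer $f$ is called an unusual conductor of $d$ if $f$ is squarefree, $f$ is divisible by a ramified prime, $f$ is not divisible by a split prime, $h(d)=|\mathrm{Pic}(\mathcal{O}_f)|=2$, and for every ramified prime $r\mid f$ and all $a,b\in\mathbb{Z}$ we have $\left|ra^2-\frac{\mathsf{d}_K}{r}b^2\right|\neq 4$. Let $D_d$ be the set of unusual conductors of $d$. Then the following conditions are equivalent: 1. $D_d=\{2\}$. 2. $p\equiv 5\bmod 8$, $y$ is odd and $d\mid y$. 3. $p\equiv 5\bmod 8$, $\left(\frac{p}{q}\right)=-1$ and $d\mid y$. -/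

import Mathlib

open scoped IntermediateField NumberField

noncomputable section

namespace UnusualOrders

/-- The real quadratic field `K = ℚ(√d)`, as a subfield of `ℝ`. -/
abbrev QuadField (d : ℕ) : IntermediateField ℚ ℝ := ℚ⟮Real.sqrt (d : ℝ)⟯

/-- The ring of algebraic integers of `ℚ(√d)`. -/
abbrev MaxOrder (d : ℕ) : Type := 𝓞 (QuadField d)

/-- The inclusion of the ring of integers of `ℚ(√d)` into `ℝ`. -/
def toReal {d : ℕ} (z : MaxOrder d) : ℝ := ((z : QuadField d) : ℝ)

/-- `ω = (1 + √d) / 2` if `d ≡ 1 mod 4` and `ω = √d` otherwise (`d` squarefree). -/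
def omega (d : ℕ) : ℝ :=
  if d % 4 = 1 then (1 + Real.sqrt (d : ℝ)) / 2 else Real.sqrt (d : ℝ)

/-- The discriminant `d_K` of `K = ℚ(√d)`, for squarefree `d`. -/
def disc (d : ℕ) : ℤ := if d % 4 = 1 then (d : ℤ) else 4 * (d : ℤ)

/-- The unit `ε > 1` of the ring of integers is the fundamental unit: every unit is `± ε ^ k`. -/
def IsFundamentalUnit (d : ℕ) (ε : (MaxOrder d)ˣ) : Prop :=
  1 < toReal (ε : MaxOrder d) ∧
    ∀ u : (MaxOrder d)ˣ, ∃ k : ℤ, u = ε ^ k ∨ u = -ε ^ k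

/-- The order `𝒪_f = ℤ + f 𝒪_K` of conductor `f`. -/
def orderOfConductor (d f : ℕ) : Subring (MaxOrder d) where
  carrier := {z | ∃ (n : ℤ) (w : MaxOrder d), z = (n : MaxOrder d) + (f : MaxOrder d) * w}
  zero_mem' := ⟨0, 0, by simp⟩
  one_mem' := ⟨1, 0, by simp⟩
  add_mem' := by
    rintro _ _ ⟨n, w, rfl⟩ ⟨m, v, rfl⟩
    exact ⟨n + m, w + v, by push_cast; ring⟩
  neg_mem' := by
    rintro _ ⟨n, w, rfl⟩
    exact ⟨-n, -w, by push_cast; ring⟩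
  mul_mem' := by
    rintro _ _ ⟨n, w, rfl⟩ ⟨m, v, rfl⟩
    exact ⟨n * m, (n : MaxOrder d) * v + (m : MaxOrder d) * w + (f : MaxOrder d) * w * v,
      by push_cast; ring⟩

/-- The number of elements of the Picard group of the order `𝒪_f` (`0` would mean infinite). -/
def picCard (d f : ℕ) : ℕ := Nat.card (CommRing.Pic (orderOfConductor d f))

/-- The class number `h(d) = |Pic(𝒪_K)|` of `K = ℚ(√d)`. -/
def classNumber (d : ℕ) : ℕ := Nat.card (CommRing.Pic (MaxOrder d))

/-- The Kronecker symbol `(a / r)` at a prime number `r`: the Legendre symbol if `r` is odd, and,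
for `r = 2`, the value `0` if `a` is even, `1` if `a ≡ ±1 mod 8`, `-1` if `a ≡ ±3 mod 8`. -/
def kronecker (a : ℤ) (r : ℕ) : ℤ := if r = 2 then ZMod.χ₈ (a : ZMod 8) else jacobiSym a r

/-- `r` is a prime number that ramifies in `ℚ(√d)`. -/
def IsRamifiedPrime (d r : ℕ) : Prop := r.Prime ∧ kronecker (disc d) r = 0

/-- `r` is a prime number that splits in `ℚ(√d)`. -/
def IsSplitPrime (d r : ℕ) : Prop := r.Prime ∧ kronecker (disc d) r = 1

/-- `f` is an unusual conductor of `d`. (The integer division `disc d / r` is exact, since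
ramified primes divide the discriminant.) -/
structure IsUnusualConductor (d f : ℕ) : Prop where
  squarefree : Squarefree f
  ramified : ∃ r : ℕ, IsRamifiedPrime d r ∧ r ∣ f
  not_split : ∀ r : ℕ, IsSplitPrime d r → ¬ r ∣ f
  classNumber_eq : classNumber d = picCard d f
  picCard_eq : picCard d f = 2
  norm_ne : ∀ r : ℕ, IsRamifiedPrime d r → r ∣ f →
    ∀ a b : ℤ, |(r : ℤ) * a ^ 2 - disc d / (r : ℤ) * b ^ 2| ≠ 4

/-- The set `D_d` of unusual conductors of `d`. -/
def unusualConductors (d : ℕ) : Set ℕ := {f | IsUnusualConductor d f}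

end UnusualOrders

end

/-! Since `q ≡ 3 mod 4`, every unit has norm `1`. The primes `2`, `p`, `q` are exactly the ramified
ones. Classes of the order of conductor `f` map to classes of `ℤ[√d]`, and the kernel is `(𝒪_K/f)ˣ`
modulo `(ℤ/f)ˣ` and the global units. Dirichlet's theorem supplies an invertible ideal of the order
with nontrivial extended class (`IsAdmissible.exists_invertibleIdeal`). Hence, given `h(d) = 2`, the
order has two classes iff the units fill this local quotient. The two directions are
`exists_unit_of_twoClasses` (any `f`) and `principalIdeal_of_map` (ramified prime conductors).

For a prime `r ∣ d` the local quotient is additive of order `r`, and `ε` generates it iff `r ∤ y`;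
for `r = 2` it has order two and is filled iff `y` is odd. An odd inert prime is impossible: units
have norm `1`, so they cannot correct an element whose norm is a nonsquare mod `r`. An unusual
conductor is therefore a product of ramified primes, and `d ∣ y` leaves only `2`.

The norm condition at `2` says that `±2` is not a norm. For `p ≡ 5 mod 8` this holds since `±2` are
nonresidues mod `p`; for `p ≡ 1 mod 8` genus theory and `h(d) = 2` make the prime above `2`
principal. At `p` and `q` the condition follows from `y` odd, because `pa² - qb² = ±1` would give a
unit incompatible with `ε` (`IsAdmissible.ne_of_odd_im`). Thus `p` and `q` would be unusual unless
they divide `y`.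

Finally, factoring `(x-1)(x+1) = dy²` yields `pa² - qb² = ±1` when `y` is even, and `±2` as a value
of `a² - db²` or `pa² - qb²` when `y` is odd. For `p ≡ 5 mod 8`, reduction mod `p` and reciprocity
turn the parity of `y` into `(p/q)`. -/

open scoped IntermediateField NumberField

/-! ### Class groups of order two in terms of integral ideals -/

/-- An ideal is invertible when some multiple of it is principal and nonzero. -/
def InvertibleIdeal {A : Type*} [CommRing A] (I : Ideal A) : Prop :=
  ∃ (J : Ideal A) (n : A), n ≠ 0 ∧ I * J = Ideal.span {n}

/-- An ideal generated by one element. -/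
def PrincipalIdeal {A : Type*} [CommRing A] (I : Ideal A) : Prop :=
  ∃ x : A, I = Ideal.span {x}

/-- The ideal-theoretic meaning of "the class group has order two". -/
def TwoClasses (A : Type*) [CommRing A] : Prop :=
  (∃ I : Ideal A, InvertibleIdeal I ∧ ¬ PrincipalIdeal I) ∧
    ∀ I J : Ideal A, InvertibleIdeal I → InvertibleIdeal J → ¬ PrincipalIdeal I →
      ¬ PrincipalIdeal J → PrincipalIdeal (I * J)

theorem Nat.card_eq_two_iff_of_group {G : Type*} [Group G] :
    Nat.card G = 2 ↔ (∃ a : G, a ≠ 1) ∧ ∀ a b : G, a ≠ 1 → b ≠ 1 → a * b = 1 := by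
  constructor
  · intro h
    have hf : Finite G := Nat.finite_of_card_ne_zero (by omega)
    obtain ⟨x, y, hxy, hu⟩ := Nat.card_eq_two_iff.1 h
    have key : ∀ z : G, z = x ∨ z = y := fun z => by
      have : z ∈ ({x, y} : Set G) := hu ▸ Set.mem_univ z
      simpa using this
    refine ⟨?_, ?_⟩
    · by_contra! hc
      exact hxy ((hc x).trans (hc y).symm)
    · intro a b ha hb
      by_contra hab
      have hba : b ≠ a * b := fun h => ha (by simpa using h.symm)
      have h1 := key 1
      have h2 := key a
      have h3 := key b
      have h4 := key (a * b)
      have haab : a ≠ a * b := fun h => hb (by simpa using h.symm)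
      grind
  · rintro ⟨⟨a, ha⟩, h⟩
    rw [Nat.card_eq_two_iff]
    refine ⟨1, a, ha.symm, ?_⟩
    ext b
    simp only [Set.mem_insert_iff, Set.mem_singleton_iff, Set.mem_univ, iff_true]
    by_cases hb : b = 1
    · exact Or.inl hb
    · right
      have h1 := h a a ha ha
      have h2 := h a b ha hb
      exact mul_left_cancel (h2.trans h1.symm)

section
variable {A : Type*} [CommRing A] [IsDomain A]
open nonZeroDivisors

theorem isUnit_coeIdeal_iff_invertibleIdeal {I : Ideal A} :
    IsUnit (I : FractionalIdeal A⁰ (FractionRing A)) ↔ InvertibleIdeal I := by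
  constructor
  · rintro ⟨u, hu⟩
    set V : FractionalIdeal A⁰ (FractionRing A) := ((u⁻¹ : _ˣ) : FractionalIdeal A⁰ (FractionRing A))
    have h1 : (I : FractionalIdeal A⁰ (FractionRing A)) * V = 1 := by
      rw [← hu]; exact u.mul_inv
    -- Clearing the denominator of the inverse fractional ideal gives the integral cofactor.
    refine ⟨V.num, V.den, nonZeroDivisors.coe_ne_zero _, ?_⟩
    have h2 := FractionalIdeal.den_mul_self_eq_num' A⁰ (FractionRing A) V
    apply FractionalIdeal.coeIdeal_injective (K := FractionRing A)
    beta_reduce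
    rw [FractionalIdeal.coeIdeal_mul, ← h2, mul_left_comm, h1, mul_one,
      FractionalIdeal.coeIdeal_span_singleton]
  · rintro ⟨J, n, hn, h⟩
    have h2 : (I : FractionalIdeal A⁰ (FractionRing A)) * J =
        FractionalIdeal.spanSingleton A⁰ (algebraMap A (FractionRing A) n) := by
      rw [← FractionalIdeal.coeIdeal_mul, h, FractionalIdeal.coeIdeal_span_singleton]
    have hn' : algebraMap A (FractionRing A) n ≠ 0 := by
      simpa using hn
    have h3 : IsUnit (FractionalIdeal.spanSingleton A⁰ (algebraMap A (FractionRing A) n)) := by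
      refine IsUnit.of_mul_eq_one
        (FractionalIdeal.spanSingleton A⁰ (algebraMap A (FractionRing A) n)⁻¹) ?_
      rw [FractionalIdeal.spanSingleton_mul_spanSingleton, mul_inv_cancel₀ hn',
        FractionalIdeal.spanSingleton_one]
    rw [← h2] at h3
    exact isUnit_of_mul_isUnit_left h3

theorem classGroup_mk_eq_one_iff_principalIdeal {I : Ideal A}
    {u : (FractionalIdeal A⁰ (FractionRing A))ˣ}
    (hu : (u : FractionalIdeal A⁰ (FractionRing A)) = I) :
    ClassGroup.mk (FractionRing A) u = 1 ↔ PrincipalIdeal I := by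
  rw [ClassGroup.mk_eq_one_of_coe_ideal hu]
  constructor
  · rintro ⟨x, -, hx⟩
    exact ⟨x, hx⟩
  · rintro ⟨x, hx⟩
    refine ⟨x, ?_, hx⟩
    rintro rfl
    apply u.ne_zero
    rw [hu, hx]
    simp

/-- A fractional ideal differs from its numerator by the principal ideal of its denominator, so
integral ideals represent all classes. -/
theorem exists_invertibleIdeal_of_classGroup (c : ClassGroup A) :
    ∃ (I : Ideal A) (u : (FractionalIdeal A⁰ (FractionRing A))ˣ),
      (u : FractionalIdeal A⁰ (FractionRing A)) = I ∧ InvertibleIdeal I ∧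
        ClassGroup.mk (FractionRing A) u = c := by
  refine ClassGroup.induction (FractionRing A) (fun V => ?_) c
  have hV : IsUnit ((V : FractionalIdeal A⁰ (FractionRing A)).num :
      FractionalIdeal A⁰ (FractionRing A)) := FractionalIdeal.isUnit_num.2 V.isUnit
  obtain ⟨u, hu⟩ := hV
  refine ⟨_, u, hu, isUnit_coeIdeal_iff_invertibleIdeal.1 (hu ▸ u.isUnit), ?_⟩
  rw [eq_comm, ClassGroup.mk_eq_mk]
  have fd_ne_zero : (algebraMap A (FractionRing A))
      (V : FractionalIdeal A⁰ (FractionRing A)).den ≠ 0 :=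
    IsFractionRing.to_map_ne_zero_of_mem_nonZeroDivisors (SetLike.coe_mem _)
  refine ⟨Units.mk0 _ fd_ne_zero, ?_⟩
  apply Units.ext
  rw [mul_comm, Units.val_mul, coe_toPrincipalIdeal, Units.val_mk0, hu]
  exact FractionalIdeal.den_mul_self_eq_num' A⁰ (FractionRing A) _

theorem card_pic_eq_two_iff : Nat.card (CommRing.Pic A) = 2 ↔ TwoClasses A := by
  rw [← Nat.card_congr (ClassGroup.equivPic A).toEquiv, Nat.card_eq_two_iff_of_group]
  constructor
  · rintro ⟨⟨a, ha⟩, h⟩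
    refine ⟨?_, ?_⟩
    · obtain ⟨I, u, hu, hI, rfl⟩ := exists_invertibleIdeal_of_classGroup a
      exact ⟨I, hI, fun hP => ha ((classGroup_mk_eq_one_iff_principalIdeal hu).2 hP)⟩
    · intro I J hI hJ hPI hPJ
      obtain ⟨u, hu⟩ := isUnit_coeIdeal_iff_invertibleIdeal.2 hI
      obtain ⟨v, hv⟩ := isUnit_coeIdeal_iff_invertibleIdeal.2 hJ
      have h1 := h (ClassGroup.mk (FractionRing A) u) (ClassGroup.mk (FractionRing A) v)
        (fun hc => hPI ((classGroup_mk_eq_one_iff_principalIdeal hu).1 hc))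
        (fun hc => hPJ ((classGroup_mk_eq_one_iff_principalIdeal hv).1 hc))
      rw [← map_mul] at h1
      refine (classGroup_mk_eq_one_iff_principalIdeal ?_).1 h1
      rw [Units.val_mul, hu, hv, FractionalIdeal.coeIdeal_mul]
  · rintro ⟨⟨I, hI, hPI⟩, h⟩
    refine ⟨?_, ?_⟩
    · obtain ⟨u, hu⟩ := isUnit_coeIdeal_iff_invertibleIdeal.2 hI
      exact ⟨_, fun hc => hPI ((classGroup_mk_eq_one_iff_principalIdeal hu).1 hc)⟩
    · intro a b ha hb
      obtain ⟨I, u, hu, hI, rfl⟩ := exists_invertibleIdeal_of_classGroup a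
      obtain ⟨J, v, hv, hJ, rfl⟩ := exists_invertibleIdeal_of_classGroup b
      rw [← map_mul]
      refine (classGroup_mk_eq_one_iff_principalIdeal
        (I := I * J) (by rw [Units.val_mul, hu, hv, FractionalIdeal.coeIdeal_mul])).2 ?_
      exact h I J hI hJ
        (fun hP => ha ((classGroup_mk_eq_one_iff_principalIdeal hu).2 hP))
        (fun hP => hb ((classGroup_mk_eq_one_iff_principalIdeal hv).2 hP))

end

section
variable {A B : Type*} [CommRing A] [CommRing B]

theorem InvertibleIdeal.map_of_injective {I : Ideal A} (h : InvertibleIdeal I) (f : A →+* B)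
    (hf : Function.Injective f) : InvertibleIdeal (I.map f) := by
  obtain ⟨J, n, hn, h⟩ := h
  refine ⟨J.map f, f n, (map_ne_zero_iff f hf).2 hn, ?_⟩
  rw [← Ideal.map_mul, h, Ideal.map_span, Set.image_singleton]

theorem PrincipalIdeal.map {I : Ideal A} (h : PrincipalIdeal I) (f : A →+* B) :
    PrincipalIdeal (I.map f) := by
  obtain ⟨x, rfl⟩ := h
  exact ⟨f x, by rw [Ideal.map_span, Set.image_singleton]⟩

theorem Ideal.map_symm_map_ringEquiv (e : A ≃+* B) (I : Ideal A) :
    (I.map (e : A →+* B)).map (e.symm : B →+* A) = I := by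
  rw [Ideal.map_map]; simp

theorem principalIdeal_map_ringEquiv_iff (e : A ≃+* B) {I : Ideal A} :
    PrincipalIdeal (I.map (e : A →+* B)) ↔ PrincipalIdeal I := by
  refine ⟨fun h => ?_, fun h => h.map _⟩
  simpa only [Ideal.map_symm_map_ringEquiv] using h.map (e.symm : B →+* A)

theorem TwoClasses.of_ringEquiv (e : A ≃+* B) (h : TwoClasses A) : TwoClasses B := by
  obtain ⟨⟨I, hI, hPI⟩, h⟩ := h
  refine ⟨⟨I.map (e : A →+* B), hI.map_of_injective _ e.injective,
    by rwa [principalIdeal_map_ringEquiv_iff]⟩, ?_⟩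
  intro I J hI hJ hPI hPJ
  rw [← principalIdeal_map_ringEquiv_iff e.symm, Ideal.map_mul]
  exact h _ _ (hI.map_of_injective _ e.symm.injective) (hJ.map_of_injective _ e.symm.injective)
    (by rwa [principalIdeal_map_ringEquiv_iff]) (by rwa [principalIdeal_map_ringEquiv_iff])

theorem twoClasses_congr (e : A ≃+* B) : TwoClasses A ↔ TwoClasses B :=
  ⟨.of_ringEquiv e, .of_ringEquiv e.symm⟩

end

/-! ### Extension and contraction of ideals between `ℤ[f√d]` and `ℤ[√d]` -/

namespace Zsqrtd

/-- The inclusion of the order `ℤ[f√d]` in `ℤ[√d]`. -/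
def conductorHom (d f : ℤ) : ℤ√(f ^ 2 * d) →+* ℤ√d where
  toFun z := ⟨z.re, f * z.im⟩
  map_one' := by ext <;> simp
  map_zero' := by ext <;> simp
  map_mul' z w := by ext <;> simp <;> ring
  map_add' z w := by ext <;> simp; ring

variable {d f r : ℤ}

@[simp] theorem re_conductorHom (z : ℤ√(f ^ 2 * d)) : (conductorHom d f z).re = z.re := rfl

@[simp] theorem im_conductorHom (z : ℤ√(f ^ 2 * d)) : (conductorHom d f z).im = f * z.im := rfl

theorem conductorHom_injective (hf : f ≠ 0) : Function.Injective (conductorHom d f) := by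
  intro z w h
  have h1 := congrArg re h
  have h2 := congrArg im h
  simp only [re_conductorHom, im_conductorHom] at h1 h2
  exact Zsqrtd.ext h1 (mul_left_cancel₀ hf h2)

theorem exists_conductorHom_eq {z : ℤ√d} (h : f ∣ z.im) : ∃ w, conductorHom d f w = z := by
  obtain ⟨k, hk⟩ := h
  exact ⟨⟨z.re, k⟩, by ext <;> simp [hk]⟩

/-- The conductor `f ℤ[√d]` lies in the order, so `f` times the extension of `I` falls back into
`I`. The free factor `s` lets the induction absorb scalars. -/
theorem exists_mem_conductorHom_eq_mul {I : Ideal (ℤ√(f ^ 2 * d))} {γ : ℤ√d}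
    (hγ : γ ∈ I.map (conductorHom d f)) (s : ℤ√d) :
    ∃ i ∈ I, conductorHom d f i = γ * f * s := by
  revert s
  refine Submodule.span_induction (p := fun γ _ => ∀ s, ∃ i ∈ I, conductorHom d f i = γ * f * s)
    ?_ ?_ ?_ ?_ hγ
  · rintro _ ⟨i, hi, rfl⟩ s
    obtain ⟨w, hw⟩ := exists_conductorHom_eq (f := f) (z := (f : ℤ√d) * s) (by simp)
    exact ⟨i * w, I.mul_mem_right _ hi, by rw [map_mul, hw, mul_assoc]⟩
  · intro s
    exact ⟨0, I.zero_mem, by simp⟩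
  · intro x y _ _ hx hy s
    obtain ⟨i, hi, hi'⟩ := hx s
    obtain ⟨j, hj, hj'⟩ := hy s
    exact ⟨i + j, I.add_mem hi hj, by rw [map_add, hi', hj']; ring⟩
  · intro a x _ hx s
    obtain ⟨i, hi, hi'⟩ := hx (a * s)
    exact ⟨i, hi, by rw [hi', smul_eq_mul]; ring⟩

/-- By `hadd` the elements of norm divisible by `r` form an ideal `P`, the prime above a ramified
`r`. If every quotient by `γ` lay in `P`, then `γ ∈ γP`, so `1 ∈ P`. -/
theorem exists_mem_not_dvd_norm [IsDomain (ℤ√d)] {I : Ideal (ℤ√(f ^ 2 * d))} {γ : ℤ√d}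
    (hr : Prime r) (hadd : ∀ a b : ℤ√d, r ∣ a.norm → r ∣ b.norm → r ∣ (a + b).norm)
    (hγ0 : γ ≠ 0) (hγ : I.map (conductorHom d f) = Ideal.span {γ}) :
    ∃ i ∈ I, ∃ w, conductorHom d f i = γ * w ∧ ¬ r ∣ w.norm := by
  by_contra! hc
  let P : Ideal (ℤ√d) :=
    { carrier := {w | r ∣ w.norm}
      add_mem' := fun {a b} ha hb => hadd a b ha hb
      zero_mem' := by simp
      smul_mem' := fun c x hx => by
        simp only [Set.mem_ofPred_eq, smul_eq_mul, norm_mul] at hx ⊢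
        exact hx.mul_left _ }
  have hle : I.map (conductorHom d f) ≤ Ideal.span {γ} * P := by
    rw [Ideal.map_le_iff_le_comap]
    intro i hi
    have h1 : conductorHom d f i ∈ Ideal.span {γ} := hγ ▸ Ideal.mem_map_of_mem _ hi
    obtain ⟨w, hw⟩ := Ideal.mem_span_singleton.1 h1
    rw [Ideal.mem_comap, hw]
    exact Ideal.mul_mem_mul (Ideal.mem_span_singleton_self _) (hc i hi w hw)
  have h2 : γ ∈ Ideal.span {γ} * P := hle (hγ ▸ Ideal.mem_span_singleton_self _)
  obtain ⟨c, hcP, hc1⟩ := Ideal.mem_span_singleton_mul.1 h2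
  have h3 : c = 1 := mul_left_cancel₀ hγ0 (by rw [hc1, mul_one])
  have h4 : r ∣ c.norm := hcP
  rw [h3, norm_one] at h4
  exact hr.not_isUnit (isUnit_of_dvd_one h4)

theorem mem_image_of_coprime {I : Ideal (ℤ√(f ^ 2 * d))} {a b : ℤ} (hab : IsCoprime a b)
    {z : ℤ√d} (ha : ∃ i ∈ I, conductorHom d f i = a * z)
    (hb : ∃ i ∈ I, conductorHom d f i = b * z) : ∃ i ∈ I, conductorHom d f i = z := by
  obtain ⟨i, hi, hi'⟩ := ha
  obtain ⟨j, hj, hj'⟩ := hb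
  obtain ⟨s, t, hst⟩ := hab
  refine ⟨(s : ℤ√(f ^ 2 * d)) * i + (t : ℤ√(f ^ 2 * d)) * j,
    I.add_mem (I.mul_mem_left _ hi) (I.mul_mem_left _ hj), ?_⟩
  rw [map_add, map_mul, map_mul, hi', hj', map_intCast, map_intCast]
  have : ((s * a + t * b : ℤ) : ℤ√d) = 1 := by rw [hst]; simp
  push_cast at this
  linear_combination z * this

/-- An invertible ideal of `ℤ[f√d]` is not stable under multiplication by `√d`. -/
theorem not_stable_of_invertible [IsDomain (ℤ√d)] (hf0 : f ≠ 0) (hf : ¬ IsUnit f)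
    {I : Ideal (ℤ√(f ^ 2 * d))} (hI : InvertibleIdeal I) :
    ¬ ∀ i ∈ I, ∃ j ∈ I, conductorHom d f j = conductorHom d f i * sqrtd := by
  intro hs
  obtain ⟨J, n, hn, h⟩ := hI
  -- The product `I * J = (n)` inherits stability; cancelling `n` would put `√d` in the order.
  have key : ∀ z ∈ I * J, ∃ z' ∈ I * J, conductorHom d f z' = conductorHom d f z * sqrtd := by
    intro z hz
    refine Submodule.mul_induction_on hz ?_ ?_
    · intro i hi j hj
      obtain ⟨k, hk, hk'⟩ := hs i hi
      exact ⟨k * j, Ideal.mul_mem_mul hk hj, by rw [map_mul, map_mul, hk']; ring⟩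
    · rintro x y ⟨x', hx, hx'⟩ ⟨y', hy, hy'⟩
      exact ⟨x' + y', (I * J).add_mem hx hy, by rw [map_add, map_add, hx', hy']; ring⟩
  obtain ⟨z, hz, hz'⟩ := key n (h ▸ Ideal.mem_span_singleton_self n)
  rw [h] at hz
  obtain ⟨c, rfl⟩ := Ideal.mem_span_singleton.1 hz
  rw [map_mul] at hz'
  have h1 := mul_left_cancel₀ ((map_ne_zero_iff _ (conductorHom_injective hf0)).2 hn) hz'
  have h2 := congrArg im h1
  simp only [im_conductorHom, im_sqrtd] at h2
  exact hf (IsUnit.of_mul_eq_one _ h2)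

/-- If every element prime to a ramified prime `r` becomes, after multiplication by a unit, an
element of the order of conductor `r`, then an invertible ideal of that order is principal as
soon as its extension to the maximal order is. -/
theorem principalIdeal_of_map [IsDomain (ℤ√d)] (hr : Prime r)
    (hadd : ∀ a b : ℤ√d, r ∣ a.norm → r ∣ b.norm → r ∣ (a + b).norm)
    (hunit : ∀ w : ℤ√d, ¬ r ∣ w.norm → ∃ η : (ℤ√d)ˣ, r ∣ (η * w : ℤ√d).im)
    {I : Ideal (ℤ√(r ^ 2 * d))} (hI : InvertibleIdeal I)
    (hP : PrincipalIdeal (I.map (conductorHom d r))) : PrincipalIdeal I := by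
  obtain ⟨γ, hγ⟩ := hP
  have hγ0 : γ ≠ 0 := by
    rintro rfl
    have h1 : I = ⊥ := by
      rw [eq_bot_iff]
      intro i hi
      have h2 : conductorHom d r i ∈ Ideal.span {(0 : ℤ√d)} := hγ ▸ Ideal.mem_map_of_mem _ hi
      rw [Ideal.mem_span_singleton, zero_dvd_iff,
        map_eq_zero_iff _ (conductorHom_injective hr.ne_zero)] at h2
      simpa using h2
    obtain ⟨J, n, hn, h⟩ := hI
    rw [h1, Ideal.bot_mul, eq_comm, Ideal.span_singleton_eq_bot] at h
    exact hn h
  obtain ⟨i₀, hi₀, w, hw, hwn⟩ := exists_mem_not_dvd_norm hr hadd hγ0 hγ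
  obtain ⟨η, hη⟩ := hunit w hwn
  -- The associate `δ` of `γ` is chosen so that the image of `i₀` is `δ` times an element `η * w` of
  -- the order; this will place `δ` itself in `I`.
  set δ : ℤ√d := γ * (η⁻¹ : (ℤ√d)ˣ) with hδ
  have hδη : δ * η = γ := by rw [hδ, mul_assoc, Units.inv_mul, mul_one]
  have hmul : ∀ s, ∃ i ∈ I, conductorHom d r i = (r : ℤ√d) * (δ * s) := by
    intro s
    obtain ⟨i, hi, hi'⟩ := exists_mem_conductorHom_eq_mul
      (hγ ▸ Ideal.mem_span_singleton_self γ : γ ∈ I.map (conductorHom d r))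
      (((η⁻¹ : (ℤ√d)ˣ) : ℤ√d) * s)
    exact ⟨i, hi, by rw [hi', hδ]; ring⟩
  have hdecomp : ∀ v : ℤ√d, v = (v.re : ℤ√d) + (v.im : ℤ√d) * (sqrtd : ℤ√d) := by
    intro v; ext <;> simp
  obtain ⟨g, hg, hg'⟩ : ∃ g ∈ I, conductorHom d r g = δ := by
    obtain ⟨k, hk⟩ := hη
    set v : ℤ√d := η * w with hv
    have hvn : ¬ r ∣ v.re := by
      intro hre
      apply hwn
      have h1 : v.norm = (η : ℤ√d).norm * w.norm := norm_mul _ _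
      have h2 : r ∣ v.norm := by
        rw [norm_def]
        exact dvd_sub (hre.mul_left _) (Dvd.dvd.mul_left ⟨k, hk⟩ _)
      rw [h1] at h2
      exact (hr.dvd_or_dvd h2).resolve_left fun h3 =>
        hr.not_isUnit (isUnit_of_dvd_unit h3 ((isUnit_iff_norm_isUnit _).1 η.isUnit))
    -- Modulo `rδℤ[√d]`, which lies in `I`, the image of `i₀` is `v.re * δ`, and `v.re` is prime to
    -- `r`.
    refine mem_image_of_coprime
      ((Irreducible.coprime_iff_not_dvd hr.irreducible).2 hvn).symm ?_ ?_ (b := r)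
    · obtain ⟨j, hj, hj'⟩ := hmul ((k : ℤ√d) * (sqrtd : ℤ√d))
      refine ⟨i₀ - j, I.sub_mem hi₀ hj, ?_⟩
      have h3 := hdecomp v
      rw [hk] at h3
      push_cast at h3
      rw [map_sub, hw, hj', ← hδη, mul_assoc, ← hv]
      linear_combination δ * h3
    · obtain ⟨j, hj, hj'⟩ := hmul 1
      exact ⟨j, hj, by rw [hj', mul_one]⟩
  refine ⟨g, _root_.le_antisymm ?_ ((Ideal.span_singleton_le_iff_mem _).2 hg)⟩
  have hdvd : ∀ i ∈ I, ∃ v, conductorHom d r i = δ * v := by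
    intro i hi
    have h1 : conductorHom d r i ∈ Ideal.span {γ} := hγ ▸ Ideal.mem_map_of_mem _ hi
    obtain ⟨c, hc⟩ := Ideal.mem_span_singleton.1 h1
    exact ⟨η * c, by rw [hc, ← hδη, mul_assoc]⟩
  intro i hi
  obtain ⟨v, hv⟩ := hdvd i hi
  by_cases hvr : r ∣ v.im
  · obtain ⟨c, hc⟩ := exists_conductorHom_eq hvr
    rw [Ideal.mem_span_singleton]
    refine ⟨c, conductorHom_injective hr.ne_zero ?_⟩
    rw [map_mul, hg', hc, hv]
  -- A quotient outside the order would put `δ√d` in `I` as well. Then `I` would be all of `δℤ[√d]`,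
  -- stable under `√d`, hence not invertible.
  · exfalso
    obtain ⟨g₁, hg₁, hg₁'⟩ : ∃ g₁ ∈ I, conductorHom d r g₁ = δ * sqrtd := by
      refine mem_image_of_coprime
        ((Irreducible.coprime_iff_not_dvd hr.irreducible).2 hvr).symm ?_ (hmul sqrtd)
      refine ⟨i - (v.re : ℤ√(r ^ 2 * d)) * g, I.sub_mem hi (I.mul_mem_left _ hg), ?_⟩
      rw [map_sub, map_mul, map_intCast, hg', hv]
      linear_combination δ * hdecomp v
    refine not_stable_of_invertible hr.ne_zero hr.not_isUnit hI fun j hj => ?_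
    obtain ⟨u, hu⟩ := hdvd j hj
    refine ⟨(u.re : ℤ√(r ^ 2 * d)) * g₁ + ((u.im * d : ℤ) : ℤ√(r ^ 2 * d)) * g,
      I.add_mem (I.mul_mem_left _ hg₁) (I.mul_mem_left _ hg), ?_⟩
    rw [map_add, map_mul, map_mul, map_intCast, map_intCast, hg', hg₁', hu]
    have h4 : (sqrtd : ℤ√d) * (sqrtd : ℤ√d) = (d : ℤ√d) := dmuld
    push_cast
    linear_combination -(δ * sqrtd) * hdecomp u - (u.im : ℤ√d) * δ * h4

/-- Extension is injective on classes by `principalIdeal_of_map`, and `L` provides a nontrivial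
class. -/
theorem twoClasses_of_unit_condition [IsDomain (ℤ√d)] (hr : Prime r)
    (hadd : ∀ a b : ℤ√d, r ∣ a.norm → r ∣ b.norm → r ∣ (a + b).norm)
    (hunit : ∀ w : ℤ√d, ¬ r ∣ w.norm → ∃ η : (ℤ√d)ˣ, r ∣ (η * w : ℤ√d).im)
    {L : Ideal (ℤ√(r ^ 2 * d))} (hL : InvertibleIdeal L)
    (hLP : ¬ PrincipalIdeal (L.map (conductorHom d r))) (h : TwoClasses (ℤ√d)) :
    TwoClasses (ℤ√(r ^ 2 * d)) := by
  refine ⟨⟨L, hL, fun hP => hLP (hP.map _)⟩, ?_⟩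
  intro I J hI hJ hPI hPJ
  obtain ⟨I', m, hm, hI'⟩ := id hI
  obtain ⟨J', n, hn, hJ'⟩ := id hJ
  have hinj := conductorHom_injective (d := d) hr.ne_zero
  have : IsDomain (ℤ√(r ^ 2 * d)) := hinj.isDomain (conductorHom d r)
  have hIJ : InvertibleIdeal (I * J) :=
    ⟨I' * J', m * n, mul_ne_zero hm hn, by
      rw [mul_mul_mul_comm, hI', hJ', Ideal.span_singleton_mul_span_singleton]⟩
  refine principalIdeal_of_map hr hadd hunit hIJ ?_
  rw [Ideal.map_mul]
  exact h.2 _ _ (hI.map_of_injective _ hinj) (hJ.map_of_injective _ hinj)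
    (fun hP => hPI (principalIdeal_of_map hr hadd hunit hI hP))
    (fun hP => hPJ (principalIdeal_of_map hr hadd hunit hJ hP))

theorem comap_mul_comap_star (hf : f ≠ 0) {u : ℤ√d} (hu : IsCoprime u.norm f) :
    (Ideal.span {u}).comap (conductorHom d f) * (Ideal.span {star u}).comap (conductorHom d f) =
      Ideal.span {(u.norm : ℤ√(f ^ 2 * d))} := by
  have hinj := conductorHom_injective (d := d) hf
  have hN : (u.norm : ℤ√d) = u * star u := norm_eq_mul_conj u
  apply _root_.le_antisymm
  · rw [Ideal.mul_le]
    intro i hi j hj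
    rw [Ideal.mem_comap, Ideal.mem_span_singleton] at hi hj
    have h1 : (u.norm : ℤ√d) ∣ conductorHom d f (i * j) := by
      rw [hN, map_mul]; exact mul_dvd_mul hi hj
    rw [intCast_dvd, re_conductorHom, im_conductorHom] at h1
    rw [Ideal.mem_span_singleton, intCast_dvd]
    exact ⟨h1.1, hu.dvd_of_dvd_mul_left h1.2⟩
  · rw [Ideal.span_singleton_le_iff_mem]
    obtain ⟨z, hz⟩ := exists_conductorHom_eq (f := f) (z := (f : ℤ√d) * u) (by simp)
    obtain ⟨z', hz'⟩ := exists_conductorHom_eq (f := f) (z := (f : ℤ√d) * star u) (by simp)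
    have h1 : (u.norm : ℤ√(f ^ 2 * d)) * u.norm ∈ (Ideal.span {u}).comap (conductorHom d f) *
        (Ideal.span {star u}).comap (conductorHom d f) := by
      refine Ideal.mul_mem_mul ?_ ?_ <;>
        rw [Ideal.mem_comap, Ideal.mem_span_singleton, map_intCast, hN]
      · exact dvd_mul_right _ _
      · exact dvd_mul_left _ _
    have h2 : z * z' ∈ (Ideal.span {u}).comap (conductorHom d f) *
        (Ideal.span {star u}).comap (conductorHom d f) := by
      refine Ideal.mul_mem_mul ?_ ?_ <;> rw [Ideal.mem_comap, Ideal.mem_span_singleton]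
      · rw [hz]; exact dvd_mul_left _ _
      · rw [hz']; exact dvd_mul_left _ _
    -- The product contains `N²` and `f²N`, where `N = u.norm`; a Bézout relation between `N` and
    -- `f²` recovers `N`.
    obtain ⟨s, t, hst⟩ := hu.pow_right (n := 2)
    have h3 : (u.norm : ℤ√(f ^ 2 * d)) = (s : ℤ√(f ^ 2 * d)) * (u.norm * u.norm) + t * (z * z') := by
      apply hinj
      simp only [map_add, map_mul, map_intCast, hz, hz']
      have h4 : ((s * u.norm + t * f ^ 2 : ℤ) : ℤ√d) = 1 := by rw [hst]; simp
      push_cast at h4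
      linear_combination -(u.norm : ℤ√d) * h4 + (t : ℤ√d) * f ^ 2 * hN
    rw [h3]
    exact Ideal.add_mem _ (Ideal.mul_mem_left _ _ h1) (Ideal.mul_mem_left _ _ h2)

theorem map_comap_span_of_coprime {u : ℤ√d} (hu : IsCoprime u.norm f) :
    ((Ideal.span {u}).comap (conductorHom d f)).map (conductorHom d f) = Ideal.span {u} := by
  refine _root_.le_antisymm Ideal.map_comap_le ?_
  rw [Ideal.span_singleton_le_iff_mem]
  have hN : (u.norm : ℤ√d) = u * star u := norm_eq_mul_conj u
  obtain ⟨z, hz⟩ := exists_conductorHom_eq (f := f) (z := (f : ℤ√d) * u) (by simp)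
  have h1 : (u.norm : ℤ√d) ∈ ((Ideal.span {u}).comap (conductorHom d f)).map (conductorHom d f) := by
    rw [← map_intCast (conductorHom d f)]
    refine Ideal.mem_map_of_mem _ ?_
    rw [Ideal.mem_comap, Ideal.mem_span_singleton, map_intCast, hN]
    exact dvd_mul_right _ _
  have h2 : (f : ℤ√d) * u ∈ ((Ideal.span {u}).comap (conductorHom d f)).map (conductorHom d f) := by
    rw [← hz]
    refine Ideal.mem_map_of_mem _ ?_
    rw [Ideal.mem_comap, Ideal.mem_span_singleton, hz]
    exact dvd_mul_left _ _
  obtain ⟨s, t, hst⟩ := hu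
  have h4 : ((s * u.norm + t * f : ℤ) : ℤ√d) = 1 := by rw [hst]; simp
  push_cast at h4
  have h3 : u = (s * u) * (u.norm : ℤ√d) + t * (f * u) := by linear_combination -u * h4
  rw [h3]
  exact Ideal.add_mem _ (Ideal.mul_mem_left _ _ (h3 ▸ h1)) (Ideal.mul_mem_left _ _ (h3 ▸ h2))

/-- The contraction of `(u)` extends back to `(u)`. Were it nonprincipal, its product with `L` would
be principal, making the extension of `L` principal. So it has a generator in the order, which is an
associate of `u`. -/
theorem exists_unit_of_twoClasses [IsDomain (ℤ√d)] (hf : f ≠ 0)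
    {L : Ideal (ℤ√(f ^ 2 * d))} (hL : InvertibleIdeal L)
    (hLP : ¬ PrincipalIdeal (L.map (conductorHom d f))) (h : TwoClasses (ℤ√(f ^ 2 * d)))
    {u : ℤ√d} (hu0 : u.norm ≠ 0) (hu : IsCoprime u.norm f) :
    ∃ η : (ℤ√d)ˣ, f ∣ (u * η : ℤ√d).im := by
  set I := (Ideal.span {u}).comap (conductorHom d f) with hI
  have hu00 : u ≠ 0 := by rintro rfl; simp at hu0
  have hInv : InvertibleIdeal I :=
    ⟨_, (u.norm : ℤ√(f ^ 2 * d)), by exact_mod_cast hu0, comap_mul_comap_star hf hu⟩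
  have hmap : I.map (conductorHom d f) = Ideal.span {u} := map_comap_span_of_coprime hu
  by_cases hP : PrincipalIdeal I
  · obtain ⟨g, hg⟩ := hP
    rw [hg, Ideal.map_span, Set.image_singleton, Ideal.span_singleton_eq_span_singleton] at hmap
    obtain ⟨η, hη⟩ := hmap.symm
    exact ⟨η, by rw [hη]; simp⟩
  · exfalso
    obtain ⟨g, hg⟩ := (h.2 I L hInv hL hP (fun hP => hLP (hP.map _))).map (conductorHom d f)
    rw [Ideal.map_mul, hmap] at hg
    have h1 : g ∈ Ideal.span {u} * L.map (conductorHom d f) := hg ▸ Ideal.mem_span_singleton_self g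
    obtain ⟨c, -, rfl⟩ := Ideal.mem_span_singleton_mul.1 h1
    rw [← Ideal.span_singleton_mul_span_singleton, Ideal.span_singleton_mul_right_inj hu00] at hg
    exact hLP ⟨c, hg⟩

/-- The norm of a generator of an ideal whose product with its conjugate is generated by `n`. -/
theorem natAbs_norm_of_mul_star {I : Ideal (ℤ√d)} {n : ℤ} {γ : ℤ√d}
    (hI : I * I.map (starRingEnd (ℤ√d)) = Ideal.span {(n : ℤ√d)}) (hγ : I = Ideal.span {γ}) :
    γ.norm.natAbs = n.natAbs := by
  rw [hγ, Ideal.map_span, Set.image_singleton, Ideal.span_singleton_mul_span_singleton,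
    starRingEnd_apply, ← norm_eq_mul_conj] at hI
  have h1 : (n : ℤ√d) ∣ γ.norm := Ideal.mem_span_singleton.1 (hI ▸ Ideal.mem_span_singleton_self _)
  have h2 : (γ.norm : ℤ√d) ∣ n := Ideal.mem_span_singleton.1 (hI ▸ Ideal.mem_span_singleton_self _)
  exact Int.natAbs_eq_of_dvd_dvd ((intCast_dvd_intCast _ _).1 h2) ((intCast_dvd_intCast _ _).1 h1)

/-- The ideal generated by an integer `n` and an element `z`. -/
def pairIdeal (d n : ℤ) (z : ℤ√d) : Ideal (ℤ√d) := Ideal.span {(n : ℤ√d), z}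

/-- The product is generated by `n²`, `n * star z`, `z * n` and `n * c`. Divided by `n`, it contains
`n`, the trace of `z` and `c`; `h` is the Bézout certificate that these generate the unit ideal. -/
theorem pairIdeal_mul_star {n c a b e : ℤ} {z : ℤ√d} (hc : z.norm = n * c)
    (h : a * n + b * (2 * z.re) + e * c = 1) :
    pairIdeal d n z * (pairIdeal d n z).map (starRingEnd (ℤ√d)) = Ideal.span {(n : ℤ√d)} := by
  have hN : (z.norm : ℤ√d) = z * star z := norm_eq_mul_conj z
  have hmap : (pairIdeal d n z).map (starRingEnd (ℤ√d)) = pairIdeal d n (star z) := by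
    rw [pairIdeal, pairIdeal, Ideal.map_span, Set.image_pair, map_intCast, starRingEnd_apply]
  rw [hmap, pairIdeal, pairIdeal, Ideal.span_pair_mul_span_pair]
  rw [hc] at hN
  push_cast at hN
  apply _root_.le_antisymm
  · rw [Ideal.span_le]
    intro x hx
    simp only [Set.mem_insert_iff, Set.mem_singleton_iff] at hx
    rw [SetLike.mem_coe, Ideal.mem_span_singleton]
    rcases hx with rfl | rfl | rfl | rfl
    · exact dvd_mul_right _ _
    · exact dvd_mul_right _ _
    · exact dvd_mul_left _ _
    · exact ⟨c, hN.symm⟩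
  · rw [Ideal.span_singleton_le_iff_mem]
    have htr : z + star z = 2 * (z.re : ℤ√d) := by ext <;> simp; ring
    have h4 : ((a * n + b * (2 * z.re) + e * c : ℤ) : ℤ√d) = 1 := by rw [h]; simp
    push_cast at h4
    have h3 : (n : ℤ√d) = a * (n * n) + b * (n * star z) + b * (z * n) + e * (z * star z) := by
      linear_combination -(n : ℤ√d) * h4 - b * n * htr + e * hN
    rw [h3]
    refine Ideal.add_mem _ (Ideal.add_mem _ (Ideal.add_mem _ ?_ ?_) ?_) ?_ <;>
      exact Ideal.mul_mem_left _ _ (Ideal.subset_span (by rw [← h3] ; simp))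

theorem invertibleIdeal_of_mul_star {I : Ideal (ℤ√d)} {n : ℤ} (hn : n ≠ 0)
    (hI : I * I.map (starRingEnd (ℤ√d)) = Ideal.span {(n : ℤ√d)}) : InvertibleIdeal I :=
  ⟨_, n, by exact_mod_cast hn, hI⟩

theorem map_pairIdeal (n : ℤ) (z : ℤ√(f ^ 2 * d)) :
    (pairIdeal _ n z).map (conductorHom d f) = pairIdeal d n (conductorHom d f z) := by
  rw [pairIdeal, pairIdeal, Ideal.map_span, Set.image_pair, map_intCast]

end Zsqrtd

/-! ### Residue symbols modulo `p` and `q` -/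

section Jacobi

theorem jacobiSym_neg_left_of_mod_four {p : ℕ} (hp4 : p % 4 = 1) (a : ℤ) :
    jacobiSym (-a) p = jacobiSym a p := by
  rw [jacobiSym.neg a (Nat.odd_iff.2 (by omega)), ZMod.χ₄_nat_one_mod_four hp4, one_mul]

theorem jacobiSym_two_of_mod_eight_eq_five {p : ℕ} (hp8 : p % 8 = 5) : jacobiSym 2 p = -1 := by
  rw [jacobiSym.at_two (Nat.odd_iff.2 (by omega)), ZMod.χ₈_nat_eq_if_mod_eight]
  simp [hp8, show p % 2 = 1 by omega]

theorem jacobiSym_two_of_mod_eight_eq_one {p : ℕ} (hp8 : p % 8 = 1) : jacobiSym 2 p = 1 := by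
  rw [jacobiSym.at_two (Nat.odd_iff.2 (by omega)), ZMod.χ₈_nat_eq_if_mod_eight]
  simp [hp8, show p % 2 = 1 by omega]

theorem jacobiSym_eq_of_dvd_sub {p : ℕ} {a b : ℤ} (h : (p : ℤ) ∣ a - b) :
    jacobiSym a p = jacobiSym b p :=
  jacobiSym.mod_left' (Int.emod_eq_emod_iff_emod_sub_eq_zero.2 (Int.emod_eq_zero_of_dvd h))

/-- The Jacobi symbol of `c` is determined by a representation `c ≡ a * b ^ 2`. -/
theorem jacobiSym_eq_of_dvd_sub_mul_sq {p : ℕ} {a b c : ℤ} (h : (p : ℤ) ∣ c - a * b ^ 2)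
    (hc : jacobiSym c p ≠ 0) : jacobiSym a p = jacobiSym c p := by
  rw [jacobiSym_eq_of_dvd_sub h, jacobiSym.mul_left, jacobiSym.pow_left] at hc ⊢
  rcases jacobiSym.trichotomy b p with hb | hb | hb <;> simp [hb] at hc ⊢

theorem jacobiSym_ne_neg_one_of_dvd_sub_sq {p : ℕ} {b c : ℤ} (h : (p : ℤ) ∣ c - b ^ 2) :
    jacobiSym c p ≠ -1 := by
  intro hc
  have h1 := jacobiSym_eq_of_dvd_sub_mul_sq (a := 1) (by simpa using h) (by rw [hc]; decide)
  rw [jacobiSym.one_left, hc] at h1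
  exact absurd h1 (by decide)

theorem not_dvd_sq_add_one_of_mod_four {q : ℕ} (hq : q.Prime) (hq4 : q % 4 = 3) (a : ℤ) :
    ¬ (q : ℤ) ∣ a ^ 2 + 1 := by
  intro h
  have := Fact.mk hq
  have h1 : ((a ^ 2 + 1 : ℤ) : ZMod q) = 0 := (ZMod.intCast_zmod_eq_zero_iff_dvd _ _).2 h
  push_cast at h1
  exact ZMod.exists_sq_eq_neg_one_iff.1 ⟨(a : ZMod q), by linear_combination -h1⟩ hq4

end Jacobi

/-! ### Coprime factorizations of `pqn²` -/

section Pell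

theorem Int.exists_eq_sq_of_coprime {a b c : ℤ} (ha : 0 ≤ a) (hab : IsCoprime a b)
    (h : a * b = c ^ 2) : ∃ s, a = s ^ 2 := by
  obtain ⟨s, hs | hs⟩ := Int.sq_of_gcd_eq_one (Int.isCoprime_iff_gcd_eq_one.1 hab) h
  · exact ⟨s, hs⟩
  · exact ⟨0, by nlinarith [sq_nonneg s]⟩

theorem Int.exists_eq_sq_and_eq_sq_of_coprime {a b c : ℤ} (ha : 0 ≤ a) (hb : 0 ≤ b)
    (hab : IsCoprime a b) (h : a * b = c ^ 2) : ∃ s t, a = s ^ 2 ∧ b = t ^ 2 := by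
  obtain ⟨s, hs⟩ := Int.exists_eq_sq_of_coprime ha hab h
  obtain ⟨t, ht⟩ := Int.exists_eq_sq_of_coprime hb hab.symm (by rwa [mul_comm])
  exact ⟨s, t, hs, ht⟩

/-- Coprime factors of `p q n ^ 2` are squares up to a distribution of `p` and `q`. -/
theorem Int.factors_of_coprime_mul_eq {p q u v n : ℤ} (hp : Prime p) (hq : Prime q) (hp0 : 0 < p)
    (hq0 : 0 < q) (hu : 0 ≤ u) (hv : 0 ≤ v) (huv : IsCoprime u v) (h : u * v = p * q * n ^ 2) :
    ∃ a b, (u = a ^ 2 ∧ v = p * q * b ^ 2) ∨ (u = p * q * a ^ 2 ∧ v = b ^ 2) ∨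
      (u = p * a ^ 2 ∧ v = q * b ^ 2) ∨ (u = q * a ^ 2 ∧ v = p * b ^ 2) := by
  have hpq0 : 0 < p * q := mul_pos hp0 hq0
  have hpd : p ∣ u ∨ p ∣ v := hp.dvd_or_dvd (h ▸ ⟨q * n ^ 2, by ring⟩)
  rcases hpd with ⟨u, rfl⟩ | ⟨v, rfl⟩
  · have hu' : 0 ≤ u := nonneg_of_mul_nonneg_right hu hp0
    have h1 : u * v = q * n ^ 2 := mul_left_cancel₀ hp.ne_zero (by linear_combination h)
    rcases hq.dvd_or_dvd (h1 ▸ ⟨n ^ 2, rfl⟩ : q ∣ u * v) with ⟨u, rfl⟩ | ⟨v, rfl⟩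
    · have hu'' : 0 ≤ u := nonneg_of_mul_nonneg_right hu' hq0
      have h2 : u * v = n ^ 2 := mul_left_cancel₀ hq.ne_zero (by linear_combination h1)
      obtain ⟨s, t, rfl, rfl⟩ := Int.exists_eq_sq_and_eq_sq_of_coprime hu'' hv
        huv.of_mul_left_right.of_mul_left_right h2
      exact ⟨s, t, Or.inr (Or.inl ⟨by ring, rfl⟩)⟩
    · have hv' : 0 ≤ v := nonneg_of_mul_nonneg_right hv hq0
      have h2 : u * v = n ^ 2 := mul_left_cancel₀ hq.ne_zero (by linear_combination h1)
      obtain ⟨s, t, rfl, rfl⟩ := Int.exists_eq_sq_and_eq_sq_of_coprime hu' hv'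
        huv.of_mul_left_right.of_mul_right_right h2
      exact ⟨s, t, Or.inr (Or.inr (Or.inl ⟨rfl, rfl⟩))⟩
  · have hv' : 0 ≤ v := nonneg_of_mul_nonneg_right hv hp0
    have h1 : u * v = q * n ^ 2 := mul_left_cancel₀ hp.ne_zero (by linear_combination h)
    rcases hq.dvd_or_dvd (h1 ▸ ⟨n ^ 2, rfl⟩ : q ∣ u * v) with ⟨u, rfl⟩ | ⟨v, rfl⟩
    · have hu' : 0 ≤ u := nonneg_of_mul_nonneg_right hu hq0
      have h2 : u * v = n ^ 2 := mul_left_cancel₀ hq.ne_zero (by linear_combination h1)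
      obtain ⟨s, t, rfl, rfl⟩ := Int.exists_eq_sq_and_eq_sq_of_coprime hu' hv'
        huv.of_mul_left_right.of_mul_right_right h2
      exact ⟨s, t, Or.inr (Or.inr (Or.inr ⟨rfl, rfl⟩))⟩
    · have hv'' : 0 ≤ v := nonneg_of_mul_nonneg_right hv' hq0
      have h2 : u * v = n ^ 2 := mul_left_cancel₀ hq.ne_zero (by linear_combination h1)
      obtain ⟨s, t, rfl, rfl⟩ := Int.exists_eq_sq_and_eq_sq_of_coprime hu hv''
        huv.of_mul_right_right.of_mul_right_right h2
      exact ⟨s, t, Or.inl ⟨rfl, by ring⟩⟩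

end Pell

/-! ### The fundamental unit and the forms `a² - db²`, `pa² - qb²` -/

namespace Zsqrtd

/-- Norm `-1` would make `-1` a square modulo `q`. -/
theorem norm_eq_one_of_unit {q : ℕ} (hq : q.Prime) (hq4 : q % 4 = 3) {d : ℤ} (hqd : (q : ℤ) ∣ d)
    (u : (ℤ√d)ˣ) : (u : ℤ√d).norm = 1 := by
  rcases Int.isUnit_iff.1 ((isUnit_iff_norm_isUnit _).1 u.isUnit) with h | h
  · exact h
  · exfalso
    obtain ⟨c, hc⟩ := hqd
    refine not_dvd_sq_add_one_of_mod_four hq hq4 (u : ℤ√d).re ⟨c * (u : ℤ√d).im ^ 2, ?_⟩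
    rw [norm_def] at h
    linear_combination h + (u : ℤ√d).im ^ 2 * hc

/-- `e` generates the unit group up to sign, and has infinite order. -/
structure IsFundamental {d : ℤ} (e : (ℤ√d)ˣ) : Prop where
  eq_zpow : ∀ u : (ℤ√d)ˣ, ∃ k : ℤ, u = e ^ k ∨ u = -e ^ k
  zpow_ne_one : ∀ k : ℤ, e ^ k = 1 → k = 0
  re_nonneg : 0 ≤ (e : ℤ√d).re

theorem IsFundamental.ne_sq {d : ℤ} {e : (ℤ√d)ˣ} (he : IsFundamental e) (u : (ℤ√d)ˣ) :
    e ≠ u ^ 2 := by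
  intro h
  obtain ⟨k, hk⟩ := he.eq_zpow u
  have h1 : e = e ^ (2 * k) := by
    rw [zpow_mul', zpow_ofNat]
    rcases hk with rfl | rfl
    · exact h
    · rwa [neg_sq] at h
  have h2 : e ^ (2 * k - 1) = 1 := by
    rw [zpow_sub_one, ← h1, mul_inv_cancel]
  have := he.zpow_ne_one _ h2
  omega

/-- `d = p * q` for primes `p ≡ 1` and `q ≡ 3` modulo `4`. -/
structure IsAdmissible (p q : ℕ) (d : ℤ) : Prop where
  prime_left : p.Prime
  prime_right : q.Prime
  left_mod : p % 4 = 1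
  right_mod : q % 4 = 3
  eq_mul : d = p * q

section
variable {p q : ℕ} {d : ℤ} {e : (ℤ√d)ˣ}

theorem IsAdmissible.mod_four (h : IsAdmissible p q d) : d % 4 = 3 := by
  have h1 := h.left_mod
  have h2 := h.right_mod
  have h3 : (p : ℤ) % 4 = 1 := by omega
  have h4 : (q : ℤ) % 4 = 3 := by omega
  rw [h.eq_mul, Int.mul_emod, h3, h4]; rfl

theorem IsAdmissible.norm_unit (h : IsAdmissible p q d) (u : (ℤ√d)ˣ) : (u : ℤ√d).norm = 1 :=
  norm_eq_one_of_unit h.prime_right h.right_mod ⟨p, by rw [h.eq_mul]; ring⟩ u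

theorem IsAdmissible.pell_eq (h : IsAdmissible p q d) (u : (ℤ√d)ˣ) :
    (u : ℤ√d).re ^ 2 - d * (u : ℤ√d).im ^ 2 = 1 := by
  rw [← h.norm_unit u, norm_def]; ring

theorem IsAdmissible.one_le_re (h : IsAdmissible p q d) (he : IsFundamental e) :
    1 ≤ (e : ℤ√d).re := by
  have h1 := h.pell_eq e
  have h2 := he.re_nonneg
  have hd : 0 ≤ d := by rw [h.eq_mul]; positivity
  by_contra hc
  have h3 : (e : ℤ√d).re = 0 := by omega
  rw [h3] at h1
  nlinarith [mul_nonneg hd (sq_nonneg (e : ℤ√d).im)]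

theorem IsAdmissible.even_re_iff (h : IsAdmissible p q d) (u : (ℤ√d)ˣ) :
    Even (u : ℤ√d).re ↔ Odd (u : ℤ√d).im := by
  have h1 := h.pell_eq u
  have h2 : Odd d := Int.odd_iff.2 (by have := h.mod_four; omega)
  have h3 : Odd ((u : ℤ√d).re ^ 2 - d * (u : ℤ√d).im ^ 2) := by rw [h1]; exact odd_one
  rw [Int.odd_sub, Int.odd_pow, Int.even_mul, Int.even_pow] at h3
  rw [← Int.not_odd_iff_even, ← Int.not_even_iff_odd (n := (u : ℤ√d).im)]
  rw [← Int.not_even_iff_odd] at h2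
  simp only [ne_eq, OfNat.ofNat_ne_zero, not_false_eq_true, and_true, or_false] at h3
  tauto

/-- Write `e = (2m+1) + 2n√d`, so `m(m+1) = pqn²` with coprime factors. Of the four splittings, `m =
a²` makes `-1` a square mod `q`, and `m + 1 = b²` makes `e` a square. -/
theorem IsAdmissible.exists_of_even_im (h : IsAdmissible p q d) (he : IsFundamental e)
    (hy : Even (e : ℤ√d).im) : ∃ a b : ℤ, p * a ^ 2 - q * b ^ 2 = 1 ∨ p * a ^ 2 - q * b ^ 2 = -1 := by
  have hx : Odd (e : ℤ√d).re := by
    rw [← Int.not_even_iff_odd, h.even_re_iff, Int.not_odd_iff_even]; exact hy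
  obtain ⟨m, hm⟩ := hx
  obtain ⟨n, hn⟩ := even_iff_exists_two_mul.1 hy
  have h1 := h.pell_eq e
  have hm0 : 0 ≤ m := by have := h.one_le_re he; omega
  have h2 : m * (m + 1) = p * q * n ^ 2 := by
    rw [hm, hn] at h1
    have h3 := h.eq_mul
    have : 4 * (m * (m + 1)) = 4 * (p * q * n ^ 2) := by
      linear_combination h1 + 4 * n ^ 2 * h3
    omega
  obtain ⟨a, b, ⟨hu, hv⟩ | ⟨hu, hv⟩ | ⟨hu, hv⟩ | ⟨hu, hv⟩⟩ := Int.factors_of_coprime_mul_eq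
    (Nat.prime_iff_prime_int.1 h.prime_left) (Nat.prime_iff_prime_int.1 h.prime_right)
    (by exact_mod_cast h.prime_left.pos) (by exact_mod_cast h.prime_right.pos) hm0 (by omega)
    (⟨-1, 1, by ring⟩ : IsCoprime m (m + 1)) h2
  · exfalso
    exact not_dvd_sq_add_one_of_mod_four h.prime_right h.right_mod a
      ⟨p * b ^ 2, by linear_combination hv - hu⟩
  · exfalso
    have hd := h.eq_mul
    have hw : b ^ 2 - d * a ^ 2 = 1 := by linear_combination hu - hv - a ^ 2 * hd
    have hab : (a * b) ^ 2 = n ^ 2 := by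
      refine mul_left_cancel₀ (a := (p * q : ℤ)) ?_ ?_
      · exact_mod_cast (Nat.mul_pos h.prime_left.pos h.prime_right.pos).ne'
      · linear_combination h2 - (m + 1) * hu - p * q * a ^ 2 * hv
    -- The sign of `a` must be adjusted so that `(b + a'√d)²` is `e` and not its conjugate.
    have key : ∀ a' : ℤ, a' ^ 2 = a ^ 2 → a' * b = n → False := by
      intro a' ha' hn'
      have hunit : IsUnit (⟨b, a'⟩ : ℤ√d) := by
        rw [isUnit_iff_norm_isUnit, norm_def]
        have : b * b - d * a' * a' = 1 := by linear_combination hw - d * ha'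
        simp [this]
      refine he.ne_sq hunit.unit (Units.ext ?_)
      rw [Units.val_pow_eq_pow_val, IsUnit.unit_spec, sq]
      ext
      · simp only [re_mul]; rw [hm]
        linear_combination hu + hv - d * ha' - a ^ 2 * hd
      · simp only [im_mul]; rw [hn]
        linear_combination -2 * hn'
    rcases sq_eq_sq_iff_eq_or_eq_neg.1 hab with h4 | h4
    · exact key a rfl h4
    · exact key (-a) (by ring) (by linear_combination -h4)
  · exact ⟨a, b, Or.inr (by linear_combination hv - hu)⟩
  · exact ⟨b, a, Or.inl (by linear_combination hu - hv)⟩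

theorem IsAdmissible.exists_of_odd_im (h : IsAdmissible p q d) (he : IsFundamental e)
    (hy : Odd (e : ℤ√d).im) : ∃ a b : ℤ, (a ^ 2 - d * b ^ 2 = 2 ∨ a ^ 2 - d * b ^ 2 = -2) ∨
      (p * a ^ 2 - q * b ^ 2 = 2 ∨ p * a ^ 2 - q * b ^ 2 = -2) := by
  obtain ⟨m, hm⟩ := even_iff_exists_two_mul.1 ((h.even_re_iff e).2 hy)
  have h1 := h.pell_eq e
  have hm0 := h.one_le_re he
  have hd := h.eq_mul
  obtain ⟨a, b, ⟨hu, hv⟩ | ⟨hu, hv⟩ | ⟨hu, hv⟩ | ⟨hu, hv⟩⟩ := Int.factors_of_coprime_mul_eq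
    (Nat.prime_iff_prime_int.1 h.prime_left) (Nat.prime_iff_prime_int.1 h.prime_right)
    (by exact_mod_cast h.prime_left.pos) (by exact_mod_cast h.prime_right.pos)
    (by omega : 0 ≤ (e : ℤ√d).re - 1) (by omega : 0 ≤ (e : ℤ√d).re + 1)
    (⟨m, 1 - m, by rw [hm]; ring⟩ : IsCoprime ((e : ℤ√d).re - 1) ((e : ℤ√d).re + 1))
    (n := (e : ℤ√d).im) (by linear_combination h1 + (e : ℤ√d).im ^ 2 * hd)
  · exact ⟨a, b, Or.inl (Or.inr (by linear_combination hv - hu - b ^ 2 * hd))⟩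
  · exact ⟨b, a, Or.inl (Or.inl (by linear_combination hu - hv - a ^ 2 * hd))⟩
  · exact ⟨a, b, Or.inr (Or.inr (by linear_combination hv - hu))⟩
  · exact ⟨b, a, Or.inr (Or.inl (by linear_combination hu - hv))⟩

/-- The square of `a√p + b√q` is a unit with even `√d`-coefficient, equal to `±e ^ k`. Odd `k` gives
an odd coefficient, so the unit is `±w²`; comparing real parts and norms gives `w.re² = pa²` or
`qb²`, contradicting that `w` has norm `1`. -/
theorem IsAdmissible.ne_of_odd_im (h : IsAdmissible p q d) (he : IsFundamental e)
    (hy : Odd (e : ℤ√d).im) (a b : ℤ) : ¬ (p * a ^ 2 - q * b ^ 2 = 1 ∨ p * a ^ 2 - q * b ^ 2 = -1) := by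
  intro hab
  have hd := h.eq_mul
  have hn : (p * a ^ 2 - q * b ^ 2) ^ 2 = 1 := by rcases hab with h | h <;> rw [h] <;> rfl
  have hunit : IsUnit (⟨p * a ^ 2 + q * b ^ 2, 2 * a * b⟩ : ℤ√d) := by
    rw [isUnit_iff_norm_isUnit, norm_def]
    have : (p * a ^ 2 + q * b ^ 2) * (p * a ^ 2 + q * b ^ 2) - d * (2 * a * b) * (2 * a * b) = 1 := by
      linear_combination hn - 4 * a ^ 2 * b ^ 2 * hd
    simp only [this, isUnit_one]
  obtain ⟨k, hk⟩ := he.eq_zpow hunit.unit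
  obtain ⟨j, hj | hj⟩ := Int.even_or_odd' k
  · have h1 : ((e ^ k : (ℤ√d)ˣ) : ℤ√d) = ((e ^ j : (ℤ√d)ˣ) : ℤ√d) ^ 2 := by
      rw [hj, zpow_mul', zpow_ofNat, Units.val_pow_eq_pow_val]
    set w : ℤ√d := ((e ^ j : (ℤ√d)ˣ) : ℤ√d) with hw
    have hwn := h.pell_eq (e ^ j)
    rw [← hw] at hwn
    have hpos : 0 ≤ d := by rw [hd]; positivity
    have hre : ((e ^ k : (ℤ√d)ˣ) : ℤ√d).re = w.re ^ 2 + d * w.im ^ 2 := by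
      rw [h1, sq, re_mul]; ring
    have hre' : p * a ^ 2 + q * b ^ 2 = w.re ^ 2 + d * w.im ^ 2 := by
      have hp0 : (0 : ℤ) ≤ p * a ^ 2 + q * b ^ 2 := by positivity
      have hdw : 0 ≤ d * w.im ^ 2 := by positivity
      rcases hk with hk | hk
      · have := congrArg (fun u : (ℤ√d)ˣ => (u : ℤ√d).re) hk
        simp only [IsUnit.unit_spec] at this
        rw [this, hre]
      · have := congrArg (fun u : (ℤ√d)ˣ => (u : ℤ√d).re) hk
        simp only [IsUnit.unit_spec, Units.val_neg, re_neg] at this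
        rw [hre] at this
        nlinarith [sq_nonneg w.re]
    have hfin : ∀ (r : ℕ) (c : ℤ), r.Prime → (r : ℤ) ∣ d → w.re ^ 2 = r * c → False := by
      intro r c hr hrd hc
      have h5 : (r : ℤ) ∣ 1 := by
        rw [← hwn, hc]
        exact dvd_sub (dvd_mul_right _ _) (hrd.mul_right _)
      exact (Nat.prime_iff_prime_int.1 hr).not_isUnit (isUnit_of_dvd_one h5)
    rcases hab with hab | hab
    · exact hfin p (a ^ 2) h.prime_left ⟨q, hd⟩ (by linarith)
    · exact hfin q (b ^ 2) h.prime_right ⟨p, by rw [hd]; ring⟩ (by linarith)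
  · have h1 : ((e ^ k : (ℤ√d)ˣ) : ℤ√d) = ((e ^ j : (ℤ√d)ˣ) : ℤ√d) ^ 2 * e := by
      rw [hj, zpow_add_one, zpow_mul', zpow_ofNat, Units.val_mul, Units.val_pow_eq_pow_val]
    have hodd : Odd ((e ^ k : (ℤ√d)ˣ) : ℤ√d).im := by
      have hx := (h.even_re_iff e).2 hy
      have hwn := h.pell_eq (e ^ j)
      set w : ℤ√d := ((e ^ j : (ℤ√d)ˣ) : ℤ√d)
      have h2 : ((e ^ k : (ℤ√d)ˣ) : ℤ√d).im =
          (1 + 2 * (d * w.im ^ 2)) * (e : ℤ√d).im + 2 * (w.re * w.im) * (e : ℤ√d).re := by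
        rw [h1, sq, im_mul, re_mul, im_mul]
        linear_combination (e : ℤ√d).im * hwn
      rw [h2]
      refine Odd.add_even (Odd.mul ⟨d * w.im ^ 2, by ring⟩ hy) (hx.mul_left _)
    have heven : Even ((hunit.unit : (ℤ√d)ˣ) : ℤ√d).im := ⟨a * b, by
      rw [IsUnit.unit_spec]; ring⟩
    rw [← Int.not_even_iff_odd] at hodd
    apply hodd
    rcases hk with hk | hk
    · rwa [hk] at heven
    · rw [hk, Units.val_neg, im_neg] at heven
      exact (even_neg).1 heven

end
end Zsqrtd

/-! ### The genus character at `p`, and orders with two classes -/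

namespace Zsqrtd

variable {p q : ℕ} {d : ℤ} {e : (ℤ√d)ˣ}

theorem isDomain_of_mod_four (hd : d % 4 = 3) : IsDomain (ℤ√d) := by
  have hns : ∀ n : ℤ, d ≠ n * n := by
    rintro n rfl
    have : n % 4 = 0 ∨ n % 4 = 1 ∨ n % 4 = 2 ∨ n % 4 = 3 := by omega
    rcases this with h | h | h | h <;> simp [Int.mul_emod, h] at hd
  have : NoZeroDivisors (ℤ√d) := ⟨fun {a b} hab => by
    have h1 := congrArg norm hab
    rw [norm_mul, norm_zero, mul_eq_zero, norm_eq_zero hns, norm_eq_zero hns] at h1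
    exact h1⟩
  exact NoZeroDivisors.to_isDomain _

/-- An ideal whose "norm" is a nonresidue modulo `p` is not principal. -/
theorem IsAdmissible.not_principalIdeal (h : IsAdmissible p q d) {I : Ideal (ℤ√d)} {n : ℤ}
    (hI : I * I.map (starRingEnd (ℤ√d)) = Ideal.span {(n : ℤ√d)}) (hn : jacobiSym n p = -1) :
    ¬ PrincipalIdeal I := by
  rintro ⟨γ, hγ⟩
  have h1 := natAbs_norm_of_mul_star hI hγ
  have h2 : jacobiSym γ.norm p = -1 := by
    rcases Int.natAbs_eq_natAbs_iff.1 h1 with h3 | h3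
    · rw [h3, hn]
    · rw [h3, jacobiSym_neg_left_of_mod_four h.left_mod, hn]
  refine jacobiSym_ne_neg_one_of_dvd_sub_sq (b := γ.re) ⟨-(q * γ.im ^ 2), ?_⟩ h2
  rw [norm_def]
  linear_combination -γ.im ^ 2 * h.eq_mul

theorem exists_jacobiSym_eq_neg_one {p : ℕ} (hp : p.Prime) (hp2 : p ≠ 2) :
    ∃ n : ℕ, jacobiSym n p = -1 := by
  have := Fact.mk hp
  obtain ⟨a, ha⟩ := FiniteField.exists_nonsquare (F := ZMod p) (by rwa [ZMod.ringChar_zmod_n])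
  refine ⟨a.val, ZMod.nonsquare_iff_jacobiSym_eq_neg_one.2 ?_⟩
  simpa using ha

/-- Dirichlet's theorem gives `l ≡ 1 mod 4` that is a nonresidue mod both `p` and `q`. By
reciprocity `d` is then a square mod `l`, although the genus character of `l` at `p` is nontrivial.
-/
theorem IsAdmissible.exists_prime (h : IsAdmissible p q d) (N : ℕ) :
    ∃ l : ℕ, l.Prime ∧ N < l ∧ jacobiSym l p = -1 ∧ ∃ m : ℤ, (l : ℤ) ∣ m ^ 2 - d := by
  have hpo : Odd p := Nat.odd_iff.2 (by have := h.left_mod; omega)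
  have hqo : Odd q := Nat.odd_iff.2 (by have := h.right_mod; omega)
  have hpq : p ≠ q := by
    rintro rfl; have := h.left_mod; have := h.right_mod; omega
  have hpq' : p.Coprime q := (Nat.coprime_primes h.prime_left h.prime_right).2 hpq
  obtain ⟨a, ha⟩ := exists_jacobiSym_eq_neg_one h.prime_left (by rintro rfl; exact absurd h.left_mod (by decide))
  obtain ⟨b, hb⟩ := exists_jacobiSym_eq_neg_one h.prime_right (by rintro rfl; exact absurd h.right_mod (by decide))
  obtain ⟨c, hca, hcb⟩ := Nat.chineseRemainder hpq' a b
  have hpq4 : (p * q).Coprime 4 := by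
    have : (p * q).Coprime (2 ^ 2) := (Nat.coprime_two_right.2 (hpo.mul hqo)).pow_right 2
    exact this
  obtain ⟨t, htc, ht4⟩ := Nat.chineseRemainder hpq4 c 1
  have hcast : ∀ {s : ℕ} {u v : ℕ}, u ≡ v [MOD s] → jacobiSym (u : ℤ) s = jacobiSym v s := by
    intro s u v huv
    exact jacobiSym.mod_left' (by exact_mod_cast huv)
  have htp : t ≡ a [MOD p] := (htc.of_mul_right q).trans hca
  have htq : t ≡ b [MOD q] := (htc.of_mul_left p).trans hcb
  have hcop : t.Coprime (p * q * 4) := by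
    have hcp : ∀ {s : ℕ}, s.Prime → jacobiSym (t : ℤ) s = -1 → t.Coprime s := by
      intro s hs hts
      have : NeZero s := ⟨hs.ne_zero⟩
      by_contra hc
      have h0 : jacobiSym (t : ℤ) s = 0 := jacobiSym.eq_zero_iff_not_coprime.2 (by simpa using hc)
      rw [h0] at hts
      exact absurd hts (by decide)
    refine Nat.Coprime.mul_right (Nat.Coprime.mul_right ?_ ?_) ?_
    · exact hcp h.prime_left (by rw [hcast htp, ha])
    · exact hcp h.prime_right (by rw [hcast htq, hb])
    · have := ht4.gcd_eq
      simpa [Nat.Coprime] using this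
  obtain ⟨l, hlN, hl, hlt⟩ := Nat.forall_exists_prime_gt_and_modEq (max N (max p q))
    (by have := h.prime_left.pos; have := h.prime_right.pos; positivity) hcop
  have hl4 : l % 4 = 1 := (hlt.of_mul_left (p * q)).trans ht4
  have hlp : l ≡ a [MOD p] := ((hlt.of_mul_right 4).of_mul_right q).trans htp
  have hlq : l ≡ b [MOD q] := ((hlt.of_mul_right 4).of_mul_left p).trans htq
  have hjp : jacobiSym l p = -1 := by rw [hcast hlp, ha]
  have hjq : jacobiSym l q = -1 := by rw [hcast hlq, hb]
  refine ⟨l, hl, by omega, hjp, ?_⟩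
  have := Fact.mk hl
  have hd : jacobiSym d l = 1 := by
    rw [h.eq_mul, jacobiSym.mul_left, ← jacobiSym.quadratic_reciprocity_one_mod_four hl4 hpo,
      ← jacobiSym.quadratic_reciprocity_one_mod_four hl4 hqo, hjp, hjq]
    rfl
  obtain ⟨m, hm⟩ := ZMod.isSquare_of_jacobiSym_eq_one hd
  refine ⟨(m.val : ℤ), (ZMod.intCast_zmod_eq_zero_iff_dvd _ _).1 ?_⟩
  push_cast
  rw [ZMod.natCast_zmod_val, hm]; ring

/-- Every order has an invertible ideal whose class is nontrivial in the maximal order. -/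
theorem IsAdmissible.exists_ideal (h : IsAdmissible p q d) {f : ℕ} (hf : f ≠ 0) :
    ∃ (l : ℕ) (L : Ideal (ℤ√((f : ℤ) ^ 2 * d))), l ≠ 0 ∧ jacobiSym l p = -1 ∧ InvertibleIdeal L ∧
      L.map (conductorHom d f) * (L.map (conductorHom d f)).map (starRingEnd (ℤ√d)) =
        Ideal.span {((l : ℤ) : ℤ√d)} := by
  -- The lower bound on `l` excludes the prime factors of `2`, `f` and `d`, so `l` is prime to the
  -- trace `2fm` of the second generator `f(m + √d)`.
  obtain ⟨l, hl, hlN, hlp, m, c, hc⟩ := h.exists_prime (2 * f * (p * q))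
  have hlprime := Nat.prime_iff_prime_int.1 hl
  have hp := h.prime_left
  have hq := h.prime_right
  have hnd : ∀ a : ℕ, 0 < a → a ≤ 2 * f * (p * q) → ¬ (l : ℤ) ∣ a := by
    intro a ha0 ha hdvd
    have := Nat.le_of_dvd ha0 (Int.natCast_dvd_natCast.1 hdvd)
    omega
  have hcop : IsCoprime (l : ℤ) (2 * (f * m)) := by
    rw [Irreducible.coprime_iff_not_dvd hlprime.irreducible]
    intro hdvd
    have hpq : 0 < p * q := Nat.mul_pos hp.pos hq.pos
    have hf0 : 0 < f := Nat.pos_of_ne_zero hf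
    rcases hlprime.dvd_or_dvd hdvd with h1 | h1
    · exact hnd 2 (by norm_num) (by nlinarith [Nat.mul_pos hf0 hpq]) (by exact_mod_cast h1)
    rcases hlprime.dvd_or_dvd h1 with h1 | h1
    · exact hnd f hf0 (by nlinarith) h1
    · refine hnd (p * q) hpq (by nlinarith) ?_
      have h2 : (l : ℤ) ∣ d := by
        have h3 : d = m * m - l * c := by linear_combination -hc
        rw [h3]
        exact dvd_sub (h1.mul_left _) (dvd_mul_right _ _)
      rw [h.eq_mul] at h2
      exact_mod_cast h2
  obtain ⟨a, b, hab⟩ := hcop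
  have key := pairIdeal_mul_star (d := (f : ℤ) ^ 2 * d) (n := l) (c := f ^ 2 * c) (a := a) (b := b)
    (e := 0) (z := ⟨f * m, 1⟩) (by rw [norm_def]; linear_combination (f : ℤ) ^ 2 * hc)
    (by linear_combination hab)
  refine ⟨l, pairIdeal _ l ⟨f * m, 1⟩, hl.ne_zero, hlp,
    invertibleIdeal_of_mul_star (by exact_mod_cast hl.ne_zero) key, ?_⟩
  rw [map_pairIdeal]
  refine pairIdeal_mul_star (c := f ^ 2 * c) (a := a) (b := b) (e := 0) ?_ ?_
  · rw [norm_def]; simp only [re_conductorHom, im_conductorHom]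
    linear_combination (f : ℤ) ^ 2 * hc
  · simp only [re_conductorHom]
    linear_combination hab

theorem IsAdmissible.exists_invertibleIdeal (h : IsAdmissible p q d) {f : ℕ} (hf : f ≠ 0) :
    ∃ L : Ideal (ℤ√((f : ℤ) ^ 2 * d)), InvertibleIdeal L ∧
      ¬ PrincipalIdeal (L.map (conductorHom d f)) := by
  obtain ⟨l, L, -, hl, hL, hLs⟩ := h.exists_ideal hf
  exact ⟨L, hL, h.not_principalIdeal hLs hl⟩

/-- If the class number is two and `p ≡ 1` modulo `8`, the prime above `2` is principal. -/
theorem IsAdmissible.exists_norm_eq_two (h : IsAdmissible p q d) (hS : TwoClasses (ℤ√d))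
    (hp8 : p % 8 = 1) : ∃ γ : ℤ√d, γ.norm.natAbs = 2 := by
  have hd4 := h.mod_four
  obtain ⟨c, hc⟩ : ∃ c, 1 - d = 2 * (2 * c + 1) := ⟨(-1 - d) / 4, by omega⟩
  -- This is the prime `(2, 1 + √d)`; since `d ≡ 3 mod 4`, the norm of `1 + √d` is twice an odd
  -- number.
  have hP := pairIdeal_mul_star (d := d) (n := 2) (c := 2 * c + 1) (a := -c) (b := 0) (e := 1)
    (z := ⟨1, 1⟩) (by rw [norm_def]; linear_combination hc) (by ring)
  by_contra hno
  push Not at hno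
  have hPP : ¬ PrincipalIdeal (pairIdeal d 2 ⟨1, 1⟩) := by
    rintro ⟨γ, hγ⟩
    exact hno γ (natAbs_norm_of_mul_star hP hγ)
  obtain ⟨l, L, hl0, hl, -, hLs⟩ := h.exists_ideal one_ne_zero
  have hL : InvertibleIdeal (L.map (conductorHom d (1 : ℕ))) :=
    invertibleIdeal_of_mul_star (by exact_mod_cast hl0) hLs
  have hLP := h.not_principalIdeal hLs hl
  -- If the prime above `2` were nonprincipal, its product with `L` would be principal, yet `2l` is
  -- a nonresidue mod `p`.
  refine h.not_principalIdeal (n := 2 * l) ?_ ?_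
    (hS.2 _ _ (invertibleIdeal_of_mul_star two_ne_zero hP) hL hPP hLP)
  · rw [Ideal.map_mul, mul_mul_mul_comm, hP, hLs, Ideal.span_singleton_mul_span_singleton]
    push_cast; rfl
  · rw [jacobiSym.mul_left, hl, jacobiSym_two_of_mod_eight_eq_one hp8]; rfl

/-- The units that lie in the order of conductor `r`. -/
def orderUnits (h : IsAdmissible p q d) (r : ℤ) : Subgroup (ℤ√d)ˣ where
  carrier := {u | r ∣ (u : ℤ√d).im}
  one_mem' := by simp
  mul_mem' {a b} ha hb := by
    simp only [Set.mem_ofPred_eq, Units.val_mul, im_mul] at ha hb ⊢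
    exact dvd_add (hb.mul_left _) (ha.mul_right _)
  inv_mem' {a} ha := by
    simp only [Set.mem_ofPred_eq] at ha ⊢
    have h1 : ((a⁻¹ : (ℤ√d)ˣ) : ℤ√d) = star (a : ℤ√d) := by
      refine Units.inv_eq_of_mul_eq_one_right ?_
      rw [← norm_eq_mul_conj, h.norm_unit, Int.cast_one]
    rw [h1, im_star]
    exact ha.neg_right

theorem IsAdmissible.dvd_im_unit (h : IsAdmissible p q d) (he : IsFundamental e) {r : ℤ}
    (hr : r ∣ (e : ℤ√d).im) (u : (ℤ√d)ˣ) : r ∣ (u : ℤ√d).im := by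
  have hk : ∀ k : ℤ, e ^ k ∈ orderUnits h r := fun k => Subgroup.zpow_mem _ hr k
  obtain ⟨k, rfl | rfl⟩ := he.eq_zpow u
  · exact hk k
  · rw [Units.val_neg, im_neg]
    exact (hk k : r ∣ _).neg_right

/-- Elements with prescribed residues modulo a prime factor `r` of `f`, and prime to `f`. -/
theorem exists_coprime_norm {f r : ℕ} (hf : Squarefree f) (hr : r.Prime) (hrf : r ∣ f) {a b : ℤ}
    (hab : ¬ (r : ℤ) ∣ a ^ 2 - d * b ^ 2) :
    ∃ u : ℤ√d, IsCoprime u.norm f ∧ (r : ℤ) ∣ u.re - a ∧ (r : ℤ) ∣ u.im - b := by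
  obtain ⟨g, rfl⟩ := hrf
  have hcop : IsCoprime (r : ℤ) g := Nat.isCoprime_iff_coprime.2 (Nat.coprime_of_squarefree_mul hf)
  obtain ⟨s, t, hst⟩ := hcop
  have hrp := Nat.prime_iff_prime_int.1 hr
  -- Chinese remaindering: this is `a + b√d` modulo `r` and `1` modulo `g`.
  refine ⟨⟨a * (t * g) + s * r, b * (t * g)⟩, ?_, ⟨s * (1 - a), ?_⟩, ⟨-(s * b), ?_⟩⟩
  · rw [Nat.cast_mul]
    refine IsCoprime.mul_right ?_ ?_
    · refine ((Irreducible.coprime_iff_not_dvd hrp.irreducible).2 fun hdvd => hab ?_).symm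
      rw [norm_def] at hdvd
      have h1 : a ^ 2 - d * b ^ 2 = ((a * (t * g) + s * r) * (a * (t * g) + s * r) -
          d * (b * (t * g)) * (b * (t * g))) + r * (s * (1 + t * g) * (a ^ 2 - d * b ^ 2) -
            s * (2 * a * t * g + s * r)) := by
        linear_combination -(1 + t * g) * (a ^ 2 - d * b ^ 2) * hst
      rw [h1]
      exact dvd_add hdvd (dvd_mul_right _ _)
    · refine ⟨1, -(t * (a ^ 2 * (t * g) + 2 * a * s * r - d * b ^ 2 * (t * g)) - t * (1 + s * r)), ?_⟩
      rw [norm_def]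
      linear_combination (1 + s * r) * hst
  · simp only
    linear_combination a * hst
  · simp only
    linear_combination b * hst

/-- If the order of conductor `f` has class number two, then the units meet every residue class
modulo a prime factor of `f`. -/
theorem IsAdmissible.exists_unit (h : IsAdmissible p q d) {f r : ℕ} (hf : Squarefree f)
    (hr : r.Prime) (hrf : r ∣ f) (hT : TwoClasses (ℤ√((f : ℤ) ^ 2 * d))) {a b : ℤ}
    (hab : ¬ (r : ℤ) ∣ a ^ 2 - d * b ^ 2) :
    ∃ (u : ℤ√d) (η : (ℤ√d)ˣ), (r : ℤ) ∣ u.re - a ∧ (r : ℤ) ∣ u.im - b ∧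
      (r : ℤ) ∣ (u * η : ℤ√d).im := by
  have := isDomain_of_mod_four h.mod_four
  obtain ⟨L, hL, hLP⟩ := h.exists_invertibleIdeal hf.ne_zero
  obtain ⟨u, hu, hua, hub⟩ := exists_coprime_norm hf hr hrf hab
  have hrf' : (r : ℤ) ∣ f := Int.natCast_dvd_natCast.2 hrf
  have hu0 : u.norm ≠ 0 := by
    intro h0
    rw [h0, isCoprime_zero_left] at hu
    exact (Nat.prime_iff_prime_int.1 hr).not_isUnit (isUnit_of_dvd_unit hrf' hu)
  obtain ⟨η, hη⟩ := exists_unit_of_twoClasses (by exact_mod_cast hf.ne_zero) hL hLP hT hu0 hu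
  exact ⟨u, η, hua, hub, hrf'.trans hη⟩

/-- If `r` divided `e.im`, every unit would be rational mod `r`, hence unable to move `a + √d` into
the order. The condition on `a` only makes `a + √d` invertible mod `r`. -/
theorem IsAdmissible.not_dvd_im (h : IsAdmissible p q d) (he : IsFundamental e) {f r : ℕ}
    (hf : Squarefree f) (hr : r.Prime) (hrf : r ∣ f) (hT : TwoClasses (ℤ√((f : ℤ) ^ 2 * d)))
    {a : ℤ} (ha : ¬ (r : ℤ) ∣ a ^ 2 - d) : ¬ (r : ℤ) ∣ (e : ℤ√d).im := by
  intro hre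
  have hrp := Nat.prime_iff_prime_int.1 hr
  obtain ⟨u, η, -, hub, hη⟩ := h.exists_unit hf hr hrf hT (a := a) (b := 1) (by simpa using ha)
  have h1 := h.dvd_im_unit he hre η
  have h2 : (r : ℤ) ∣ (η : ℤ√d).re := by
    rw [im_mul] at hη
    have h3 := (dvd_add_right (h1.mul_left u.re)).1 hη
    have h4 := dvd_sub h3 (hub.mul_right (η : ℤ√d).re)
    rwa [show u.im * (η : ℤ√d).re - (u.im - 1) * (η : ℤ√d).re = (η : ℤ√d).re by ring] at h4
  have h5 : (r : ℤ) ∣ 1 := by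
    rw [← h.pell_eq η]
    exact dvd_sub (dvd_pow h2 two_ne_zero) ((dvd_pow h1 two_ne_zero).mul_left _)
  exact hrp.not_isUnit (isUnit_of_dvd_one h5)

/-- Otherwise subtracting `d` preserves squares; starting from `0`, all multiples `-n * d` are
squares, including `d` at `n = r - 1`. -/
theorem exists_not_isSquare_sq_sub {r : ℕ} [Fact r.Prime] {d : ZMod r} (hd : ¬ IsSquare d) :
    ∃ a : ℤ, ¬ IsSquare ((a : ZMod r) ^ 2 - d) := by
  by_contra! hc
  have key : ∀ n : ℕ, IsSquare (-(n : ZMod r) * d) := by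
    intro n
    induction n with
    | zero => simp
    | succ n ih =>
      obtain ⟨s, hs⟩ := ih
      have h1 := hc (s.val : ℤ)
      push_cast at h1
      rw [ZMod.natCast_zmod_val, sq, ← hs] at h1
      convert h1 using 1
      push_cast; ring
  have h2 := key (r - 1)
  rw [Nat.cast_sub (Fact.out : r.Prime).one_le] at h2
  simp at h2
  exact hd h2

/-- A unit moving `u ≡ a + √d` into the order preserves its norm, so `a² - d` is a square mod `r`;
for a nonsquare `d` some `a` violates this. -/
theorem IsAdmissible.isSquare_of_dvd (h : IsAdmissible p q d) {f r : ℕ}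
    (hf : Squarefree f) (hr : r.Prime) (hrf : r ∣ f) (hT : TwoClasses (ℤ√((f : ℤ) ^ 2 * d))) :
    IsSquare (d : ZMod r) := by
  have := Fact.mk hr
  by_contra hd
  obtain ⟨a, ha⟩ := exists_not_isSquare_sq_sub hd
  obtain ⟨u, η, hua, hub, hη⟩ := h.exists_unit hf hr hrf hT (a := a) (b := 1) (by
    intro hdvd
    apply ha
    have h1 := (ZMod.intCast_zmod_eq_zero_iff_dvd _ _).2 hdvd
    push_cast at h1
    rw [mul_one] at h1
    rw [h1]
    exact IsSquare.zero)
  apply ha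
  refine ⟨((u * η : ℤ√d).re : ZMod r), ?_⟩
  have h1 : (u * η : ℤ√d).norm = u.norm := by rw [norm_mul, h.norm_unit, mul_one]
  rw [norm_def, norm_def] at h1
  have h2 := congrArg (fun n : ℤ => (n : ZMod r)) h1
  have h3 := (ZMod.intCast_zmod_eq_zero_iff_dvd _ _).2 hη
  have h4 := (ZMod.intCast_zmod_eq_zero_iff_dvd _ _).2 hua
  have h5 := (ZMod.intCast_zmod_eq_zero_iff_dvd _ _).2 hub
  push_cast at h2 h4 h5
  rw [h3, sub_eq_zero.1 h4, sub_eq_zero.1 h5] at h2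
  linear_combination -h2

/-- Modulo `r ∣ d` the element `√d` squares to zero, so `e ^ k ≡ x ^ k + k x ^ (k-1) y √d`. The
ratio of coefficients is `k * y / x`, which takes every value when `r ∤ y`. -/
theorem IsAdmissible.twoClasses_of_dvd (h : IsAdmissible p q d) {r : ℕ}
    (hr : r.Prime) (hrd : (r : ℤ) ∣ d) (hre : ¬ (r : ℤ) ∣ (e : ℤ√d).im) (hS : TwoClasses (ℤ√d)) :
    TwoClasses (ℤ√((r : ℤ) ^ 2 * d)) := by
  have := isDomain_of_mod_four h.mod_four
  have hrp := Nat.prime_iff_prime_int.1 hr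
  have := Fact.mk hr
  obtain ⟨L, hL, hLP⟩ := h.exists_invertibleIdeal hr.ne_zero
  have hnorm : ∀ w : ℤ√d, (r : ℤ) ∣ w.norm ↔ (r : ℤ) ∣ w.re := by
    intro w
    rw [norm_def, dvd_sub_left ((hrd.mul_right _).mul_right _), hrp.dvd_mul, or_self]
  refine twoClasses_of_unit_condition hrp ?_ ?_ hL hLP hS
  · intro a b ha hb
    rw [hnorm] at ha hb ⊢
    exact dvd_add ha hb
  · intro w hw
    rw [hnorm] at hw
    have hd0 : (d : ZMod r) = 0 := (ZMod.intCast_zmod_eq_zero_iff_dvd _ _).2 hrd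
    set x : ZMod r := ((e : ℤ√d).re : ZMod r) with hx
    set y : ZMod r := ((e : ℤ√d).im : ZMod r) with hy
    -- The extra factor `x` avoids the exponent `k - 1`.
    have hpow : ∀ k : ℕ, ((((e : ℤ√d) ^ k).re : ℤ) : ZMod r) = x ^ k ∧
        ((((e : ℤ√d) ^ k).im : ℤ) : ZMod r) * x = k * x ^ k * y := by
      intro k
      induction k with
      | zero => simp
      | succ k ih =>
        obtain ⟨h1, h2⟩ := ih
        rw [pow_succ, re_mul, im_mul]
        push_cast
        rw [← hx, ← hy, h1, hd0]
        refine ⟨by ring, ?_⟩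
        linear_combination x * h2
    have hy0 : y ≠ 0 := fun h0 => hre ((ZMod.intCast_zmod_eq_zero_iff_dvd _ _).1 h0)
    have hw0 : (w.re : ZMod r) ≠ 0 := fun h0 => hw ((ZMod.intCast_zmod_eq_zero_iff_dvd _ _).1 h0)
    have hx0 : x ≠ 0 := by
      intro h0
      have h1 := congrArg (fun n : ℤ => (n : ZMod r)) (h.pell_eq e)
      push_cast at h1
      rw [← hx, h0, hd0] at h1
      simp at h1
    set k : ℕ := (-(x * w.im) / (y * w.re) : ZMod r).val
    have hk : (k : ZMod r) * (y * w.re) = -(x * w.im) := by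
      rw [ZMod.natCast_zmod_val, div_mul_cancel₀ _ (mul_ne_zero hy0 hw0)]
    refine ⟨e ^ k, (ZMod.intCast_zmod_eq_zero_iff_dvd _ _).1 ?_⟩
    apply mul_right_cancel₀ hx0
    obtain ⟨h1, h2⟩ := hpow k
    rw [Units.val_pow_eq_pow_val, im_mul]
    push_cast
    rw [h1]
    linear_combination (w.re : ZMod r) * h2 + x ^ k * hk

/-- Modulo `2` an element of odd norm is `1` or `√d`, and `e ≡ √d` exchanges the two. -/
theorem IsAdmissible.twoClasses_two (h : IsAdmissible p q d)
    (hy : Odd (e : ℤ√d).im) (hS : TwoClasses (ℤ√d)) : TwoClasses (ℤ√(((2 : ℕ) : ℤ) ^ 2 * d)) := by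
  have := isDomain_of_mod_four h.mod_four
  obtain ⟨L, hL, hLP⟩ := h.exists_invertibleIdeal two_ne_zero
  have hd2 : Odd d := Int.odd_iff.2 (by have := h.mod_four; omega)
  have hnorm : ∀ w : ℤ√d, ((2 : ℕ) : ℤ) ∣ w.norm ↔ Even (w.re + w.im) := by
    intro w
    rw [norm_def, Nat.cast_ofNat, ← even_iff_two_dvd, Int.even_sub, Int.even_add, Int.even_mul,
      Int.even_mul, Int.even_mul]
    rw [← Int.not_even_iff_odd] at hd2
    tauto
  refine twoClasses_of_unit_condition Int.prime_two ?_ ?_ hL hLP hS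
  · intro a b ha hb
    erw [hnorm] at ha hb ⊢
    rw [re_add, im_add, show a.re + b.re + (a.im + b.im) = (a.re + a.im) + (b.re + b.im) by ring]
    exact ha.add hb
  · intro w hw
    erw [hnorm] at hw
    by_cases hw2 : Even w.im
    · exact ⟨1, by simpa using hw2.two_dvd⟩
    · have hwre : Even w.re := by
        rw [Int.even_add] at hw; tauto
      refine ⟨e, ?_⟩
      rw [im_mul]
      exact (((h.even_re_iff e).2 hy).mul_right _ |>.add (hwre.mul_left _)).two_dvd

end Zsqrtd

/-! ### Integral elements of `ℚ(√d)` -/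

section IntegralElements

theorem Rat.exists_int_of_squarefree_mul_sq {d : ℕ} (hd : Squarefree d) {c : ℚ} {m : ℤ}
    (h : (d : ℚ) * c ^ 2 = m) : ∃ k : ℤ, c = k := by
  have h1 : (d : ℤ) * c.num ^ 2 = m * (c.den : ℤ) ^ 2 := by
    have hden : (c.den : ℚ) ≠ 0 := by exact_mod_cast c.den_ne_zero
    have h2 : c = c.num / c.den := (Rat.num_div_den c).symm
    rw [h2] at h
    field_simp at h
    rw [mul_comm (m : ℤ)]
    exact_mod_cast h
  have hcop : IsCoprime ((c.den : ℤ) ^ 2) (c.num ^ 2) := by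
    apply IsCoprime.pow
    rw [Int.isCoprime_iff_gcd_eq_one]
    simpa [Int.gcd] using c.reduced.symm
  have h3 : ((c.den : ℤ)) ^ 2 ∣ d := hcop.dvd_of_dvd_mul_right ⟨m, by rw [h1]; ring⟩
  have h4 : c.den * c.den ∣ d := by rw [← sq]; exact_mod_cast h3
  have h5 : c.den = 1 := Nat.isUnit_iff.1 (hd _ h4)
  exact ⟨c.num, ((Rat.den_eq_one_iff c).1 h5).symm⟩

theorem irrational_sqrt_of_mod_four {d : ℕ} (hd4 : d % 4 = 3) : Irrational (Real.sqrt d) := by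
  rw [irrational_sqrt_natCast_iff]
  rintro ⟨n, rfl⟩
  have : n % 4 = 0 ∨ n % 4 = 1 ∨ n % 4 = 2 ∨ n % 4 = 3 := by omega
  rcases this with h | h | h | h <;> simp [Nat.mul_mod, h] at hd4

open Polynomial in
-- For `b ≠ 0` the quadratic `P` is the minimal polynomial, since a rational root would make `√d`
-- rational; integrality puts its coefficients in `ℤ`.
theorem exists_int_trace_norm {d : ℕ} (hirr : Irrational (Real.sqrt d)) {a b : ℚ}
    (hx : IsIntegral ℤ ((a : ℝ) + b * Real.sqrt d)) :
    ∃ m n : ℤ, 2 * a = m ∧ a ^ 2 - d * b ^ 2 = n := by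
  have hs : Real.sqrt d ^ 2 = d := Real.sq_sqrt (Nat.cast_nonneg d)
  by_cases hb : b = 0
  · subst hb
    have h1 : IsIntegral ℤ (algebraMap ℚ ℝ a) := by simpa using hx
    have h2 : IsIntegral ℤ a := (isIntegral_algebraMap_iff (algebraMap ℚ ℝ).injective).1 h1
    obtain ⟨k, hk⟩ := IsIntegrallyClosed.isIntegral_iff.1 h2
    have hk' : (k : ℚ) = a := by simpa using hk
    exact ⟨2 * k, k ^ 2, by push_cast; rw [hk'], by push_cast; rw [hk']; ring⟩
  · set x : ℝ := (a : ℝ) + b * Real.sqrt d with hxdef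
    set P : ℚ[X] := X ^ 2 + C (-(2 * a)) * X + C (a ^ 2 - d * b ^ 2) with hP
    have hPm : P.Monic := by rw [hP]; monicity!
    have hPdeg : P.natDegree = 2 := by rw [hP]; compute_degree!
    have hroot : aeval x P = 0 := by
      simp only [hP, map_add, map_mul, map_pow, aeval_X, aeval_C, eq_ratCast]
      push_cast
      rw [hxdef]
      linear_combination (b : ℝ) ^ 2 * hs
    have hPirr : Irreducible P := by
      rw [hPm.irreducible_iff_roots_eq_zero_of_degree_le_three (by omega) (by omega),
        Multiset.eq_zero_iff_forall_notMem]
      intro r hr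
      have h1 : P.eval r = 0 := (mem_roots hPm.ne_zero).1 hr
      simp only [hP, eval_add, eval_mul, eval_pow, eval_X, eval_C] at h1
      have h2 : ((r - a) / b) ^ 2 = (d : ℚ) := by
        field_simp
        linear_combination h1
      have h3 : Real.sqrt d = |(((r - a) / b : ℚ) : ℝ)| := by
        rw [← Real.sqrt_sq_eq_abs]
        congr 1
        exact_mod_cast h2.symm
      exact hirr ⟨|(r - a) / b|, by rw [h3]; push_cast; rfl⟩
    have h1 : P = minpoly ℚ x := minpoly.eq_of_irreducible_of_monic hPirr hroot hPm
    have h2 := minpoly.isIntegrallyClosed_eq_field_fractions' ℚ hx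
    rw [← h1] at h2
    have hc0 := congrArg (fun Q => coeff Q 0) h2
    have hc1 := congrArg (fun Q => coeff Q 1) h2
    generalize a ^ 2 - d * b ^ 2 = c at hP ⊢
    simp only [hP, coeff_map] at hc0 hc1
    simp [-map_neg, -map_mul, coeff_X, coeff_C] at hc0 hc1
    exact ⟨-(minpoly ℤ x).coeff 1, (minpoly ℤ x).coeff 0, by push_cast; linarith, hc0⟩

theorem exists_int_coordinates {d : ℕ} (hd : Squarefree d) (hd4 : d % 4 = 3) {a b : ℚ}
    (hx : IsIntegral ℤ ((a : ℝ) + b * Real.sqrt d)) : ∃ m n : ℤ, a = m ∧ b = n := by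
  obtain ⟨m, n, hm, hn⟩ := exists_int_trace_norm (irrational_sqrt_of_mod_four hd4) hx
  obtain ⟨k, hk⟩ := Rat.exists_int_of_squarefree_mul_sq hd (c := 2 * b) (m := m ^ 2 - 4 * n) (by
    push_cast
    rw [← hm, ← hn]; ring)
  have h1 : (m : ℤ) ^ 2 - d * k ^ 2 = 4 * n := by
    have : (m : ℚ) ^ 2 - d * k ^ 2 = 4 * n := by
      rw [← hm, ← hn, ← hk]; ring
    exact_mod_cast this
  obtain ⟨c, hc⟩ : ∃ c : ℤ, (d : ℤ) = 4 * c + 3 := ⟨(d : ℤ) / 4, by omega⟩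
  -- As `d ≡ -1 mod 4`, a half-integral pair would give `m² + k² ≡ 0 mod 4`, which forces both even.
  have h2 : (4 : ℤ) ∣ m ^ 2 + k ^ 2 := ⟨n + (c + 1) * k ^ 2, by rw [hc] at h1; linear_combination h1⟩
  have h3 : m % 2 = 0 ∧ k % 2 = 0 := by
    have hm4 : m % 4 = 0 ∨ m % 4 = 1 ∨ m % 4 = 2 ∨ m % 4 = 3 := by omega
    have hk4 : k % 4 = 0 ∨ k % 4 = 1 ∨ k % 4 = 2 ∨ k % 4 = 3 := by omega
    have h4 := Int.emod_eq_zero_of_dvd h2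
    rcases hm4 with h | h | h | h <;> rcases hk4 with h' | h' | h' | h' <;>
      simp [sq, Int.add_emod, Int.mul_emod, h, h'] at h4 <;> omega
  obtain ⟨m', hm'⟩ := Int.dvd_of_emod_eq_zero h3.1
  obtain ⟨k', hk'⟩ := Int.dvd_of_emod_eq_zero h3.2
  refine ⟨m', k', ?_, ?_⟩
  · rw [hm'] at hm; push_cast at hm; linarith
  · rw [hk'] at hk; push_cast at hk; linarith

end IntegralElements

/-! ### Identification of `𝓞 K` and its orders with `ℤ[√d]` and `ℤ[f√d]` -/

namespace UnusualOrders

open Zsqrtd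

theorem exists_rat_coordinates (d : ℕ) (z : QuadField d) :
    ∃ a b : ℚ, (z : ℝ) = a + b * Real.sqrt d := by
  have hs : Real.sqrt d * Real.sqrt d = d := Real.mul_self_sqrt (Nat.cast_nonneg d)
  have hint : IsIntegral ℚ (Real.sqrt d) := by
    refine ⟨Polynomial.X ^ 2 - Polynomial.C (d : ℚ), Polynomial.monic_X_pow_sub_C _ two_ne_zero, ?_⟩
    simp [sq, hs]
  have hz : (z : ℝ) ∈ Algebra.adjoin ℚ {Real.sqrt (d : ℝ)} := by
    rw [← IntermediateField.adjoin_simple_toSubalgebra_of_isAlgebraic hint.isAlgebraic]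
    exact z.2
  generalize (z : ℝ) = x at hz
  induction hz using Algebra.adjoin_induction with
  | mem x hx =>
    rw [Set.mem_singleton_iff] at hx
    exact ⟨0, 1, by simp [hx]⟩
  | algebraMap r => exact ⟨r, 0, by simp⟩
  | add x y _ _ hx hy =>
    obtain ⟨a, b, rfl⟩ := hx
    obtain ⟨a', b', rfl⟩ := hy
    exact ⟨a + a', b + b', by push_cast; ring⟩
  | mul x y _ _ hx hy =>
    obtain ⟨a, b, rfl⟩ := hx
    obtain ⟨a', b', rfl⟩ := hy
    exact ⟨a * a' + b * b' * d, a * b' + a' * b, by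
      push_cast; linear_combination (b : ℝ) * b' * hs⟩

/-- The embedding of the ring of integers in `ℝ` as a ring homomorphism. -/
noncomputable def toRealHom (d : ℕ) : MaxOrder d →+* ℝ :=
  (algebraMap (QuadField d) ℝ).comp (algebraMap (MaxOrder d) (QuadField d))

theorem toRealHom_apply {d : ℕ} (z : MaxOrder d) : toRealHom d z = toReal z := rfl

theorem toReal_injective (d : ℕ) : Function.Injective (toReal : MaxOrder d → ℝ) :=
  fun _ _ h => NumberField.RingOfIntegers.ext (Subtype.ext h)

theorem isIntegral_toReal {d : ℕ} (z : MaxOrder d) : IsIntegral ℤ (toReal z) :=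
  (NumberField.RingOfIntegers.isIntegral_coe z).map (IsScalarTower.toAlgHom ℤ (QuadField d) ℝ)

/-- The element `√d` of the ring of integers. -/
noncomputable def sqrtInt (d : ℕ) : MaxOrder d :=
  ⟨IntermediateField.AdjoinSimple.gen ℚ (Real.sqrt (d : ℝ)), by
    refine ⟨Polynomial.X ^ 2 - Polynomial.C (d : ℤ), Polynomial.monic_X_pow_sub_C _ two_ne_zero, ?_⟩
    apply Subtype.ext
    simp⟩

theorem toReal_sqrtInt (d : ℕ) : toReal (sqrtInt d) = Real.sqrt d := rfl

theorem sqrtInt_mul_self (d : ℕ) : sqrtInt d * sqrtInt d = ((d : ℤ) : MaxOrder d) := by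
  apply toReal_injective
  rw [← toRealHom_apply, ← toRealHom_apply, map_mul, toRealHom_apply, toReal_sqrtInt, map_intCast]
  simp

/-- The map `ℤ[√d] → 𝓞 K`. -/
noncomputable def zsqrtdHom (d : ℕ) : ℤ√(d : ℤ) →+* MaxOrder d :=
  Zsqrtd.lift ⟨sqrtInt d, sqrtInt_mul_self d⟩

theorem toReal_zsqrtdHom (d : ℕ) (z : ℤ√(d : ℤ)) :
    toReal (zsqrtdHom d z) = z.re + z.im * Real.sqrt d := by
  rw [← toRealHom_apply, zsqrtdHom, Zsqrtd.lift_apply_apply, map_add, map_mul, map_intCast,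
    map_intCast, toRealHom_apply, toReal_sqrtInt]

theorem zsqrtdHom_bijective {d : ℕ} (hd : Squarefree d) (hd4 : d % 4 = 3) :
    Function.Bijective (zsqrtdHom d) := by
  constructor
  · apply Zsqrtd.lift_injective
    rintro n hn
    have : n % 4 = 0 ∨ n % 4 = 1 ∨ n % 4 = 2 ∨ n % 4 = 3 := by omega
    have hd' : n * n % 4 = 3 := by omega
    rcases this with h | h | h | h <;> simp [Int.mul_emod, h] at hd'
  · intro z
    obtain ⟨a, b, hab⟩ := exists_rat_coordinates d (z : QuadField d)
    have hab' : toReal z = a + b * Real.sqrt d := hab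
    have hint := isIntegral_toReal z
    rw [hab'] at hint
    obtain ⟨m, n, rfl, rfl⟩ := exists_int_coordinates hd hd4 hint
    refine ⟨⟨m, n⟩, toReal_injective d ?_⟩
    rw [toReal_zsqrtdHom, hab']
    simp

/-- The ring of integers of `ℚ(√d)` is `ℤ[√d]` for squarefree `d ≡ 3` modulo `4`. -/
noncomputable def zsqrtdEquiv {d : ℕ} (hd : Squarefree d) (hd4 : d % 4 = 3) :
    ℤ√(d : ℤ) ≃+* MaxOrder d :=
  RingEquiv.ofBijective (zsqrtdHom d) (zsqrtdHom_bijective hd hd4)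

theorem classNumber_eq_two_iff {d : ℕ} (hd : Squarefree d) (hd4 : d % 4 = 3) :
    classNumber d = 2 ↔ TwoClasses (ℤ√(d : ℤ)) := by
  rw [classNumber, card_pic_eq_two_iff, twoClasses_congr (zsqrtdEquiv hd hd4)]

theorem mem_orderOfConductor (d f : ℕ) (z : ℤ√((f : ℤ) ^ 2 * d)) :
    (zsqrtdHom d).comp (conductorHom d f) z ∈ orderOfConductor d f := by
  refine ⟨z.re, zsqrtdHom d ⟨0, z.im⟩, ?_⟩
  rw [RingHom.comp_apply, ← map_intCast (zsqrtdHom d), ← map_natCast (zsqrtdHom d), ← map_mul,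
    ← map_add]
  congr 1
  ext <;> simp

theorem order_bijective {d : ℕ} (hd : Squarefree d) (hd4 : d % 4 = 3) {f : ℕ} (hf : f ≠ 0) :
    Function.Bijective (((zsqrtdHom d).comp (conductorHom d f)).codRestrict
      (orderOfConductor d f) (mem_orderOfConductor d f)) := by
  constructor
  · intro z w h
    have h1 := congrArg Subtype.val h
    exact conductorHom_injective (by exact_mod_cast hf) ((zsqrtdHom_bijective hd hd4).1 h1)
  · rintro ⟨_, n, w, rfl⟩
    obtain ⟨v, rfl⟩ := (zsqrtdHom_bijective hd hd4).2 w
    refine ⟨⟨n + f * v.re, v.im⟩, Subtype.ext ?_⟩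
    change zsqrtdHom d (conductorHom d f _) = (n : MaxOrder d) + (f : MaxOrder d) * zsqrtdHom d v
    rw [← map_intCast (zsqrtdHom d), ← map_natCast (zsqrtdHom d), ← map_mul, ← map_add]
    congr 1
    ext <;> simp

theorem picCard_eq_two_iff {d : ℕ} (hd : Squarefree d) (hd4 : d % 4 = 3) {f : ℕ} (hf : f ≠ 0) :
    picCard d f = 2 ↔ TwoClasses (ℤ√((f : ℤ) ^ 2 * d)) := by
  rw [picCard, card_pic_eq_two_iff,
    twoClasses_congr (RingEquiv.ofBijective _ (order_bijective hd hd4 hf))]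

theorem exists_isFundamental {d : ℕ} (hd : Squarefree d) (hd4 : d % 4 = 3)
    {ε : (MaxOrder d)ˣ} (hε : IsFundamentalUnit d ε) {x y : ℕ}
    (hxy : toReal (ε : MaxOrder d) = (x : ℝ) + (y : ℝ) * omega d) :
    ∃ e : (ℤ√(d : ℤ))ˣ, IsFundamental e ∧ (e : ℤ√(d : ℤ)).im = y := by
  set E := Units.mapEquiv (zsqrtdEquiv hd hd4).toMulEquiv
  obtain ⟨e, rfl⟩ := E.surjective ε
  have hcoe : ((E e : (MaxOrder d)ˣ) : MaxOrder d) = zsqrtdHom d e := rfl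
  have he : (e : ℤ√(d : ℤ)) = ⟨x, y⟩ := by
    apply (zsqrtdHom_bijective hd hd4).1
    apply toReal_injective
    rw [← hcoe, hxy, toReal_zsqrtdHom, omega, if_neg (by omega)]
    simp
  refine ⟨e, ⟨fun u => ?_, fun k hk => ?_, by rw [he]; simp⟩, by rw [he]⟩
  · obtain ⟨k, hk | hk⟩ := hε.2 (E u)
    · exact ⟨k, Or.inl (E.injective (by rw [hk, map_zpow]))⟩
    · refine ⟨k, Or.inr (E.injective ?_)⟩
      rw [hk, ← map_zpow]
      apply Units.ext
      change -zsqrtdHom d _ = zsqrtdHom d _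
      rw [Units.val_neg, map_neg]
  · have h1 : (E e) ^ k = 1 := by rw [← map_zpow, hk, map_one]
    have h2 := congrArg (fun u => ((Units.map (toRealHom d : MaxOrder d →* ℝ) u : ℝˣ) : ℝ)) h1
    simp only [map_zpow, map_one, Units.val_zpow_eq_zpow_val, Units.val_one] at h2
    have h3 : 1 < ((Units.map (toRealHom d : MaxOrder d →* ℝ) (E e) : ℝˣ) : ℝ) := hε.1
    exact (zpow_eq_one_iff_right₀ (by linarith) h3.ne').1 h2

end UnusualOrders

/-! ### Unusual conductors -/

namespace UnusualOrders

open Zsqrtd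

theorem disc_of_mod_four {d : ℕ} (hd4 : d % 4 = 3) : disc d = 4 * d := by
  rw [disc, if_neg (by omega)]

theorem kronecker_of_ne_two {a : ℤ} {r : ℕ} (hr : r ≠ 2) : kronecker a r = jacobiSym a r := by
  rw [kronecker, if_neg hr]

theorem kronecker_four_mul_two (a : ℤ) : kronecker (4 * a) 2 = 0 := by
  rw [kronecker, if_pos rfl]
  push_cast
  rw [map_mul, show ZMod.χ₈ 4 = 0 by decide, zero_mul]

theorem isRamifiedPrime_iff {d r : ℕ} (hd4 : d % 4 = 3) (hr : r.Prime) :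
    IsRamifiedPrime d r ↔ r = 2 ∨ r ∣ d := by
  rw [IsRamifiedPrime, disc_of_mod_four hd4]
  by_cases h2 : r = 2
  · subst h2
    simp [hr, kronecker_four_mul_two]
  · have : NeZero r := ⟨hr.ne_zero⟩
    have hr4 : r.Coprime 4 := by
      have : r.Coprime (2 ^ 2) := ((Nat.coprime_primes hr Nat.prime_two).2 h2).pow_right 2
      exact this
    rw [kronecker_of_ne_two h2, jacobiSym.eq_zero_iff_not_coprime]
    have h3 : ((4 * (d : ℤ)).gcd r) = (4 * d).gcd r := by
      rw [show (4 * (d : ℤ)) = ((4 * d : ℕ) : ℤ) by push_cast; rfl, Int.gcd_natCast_natCast]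
    rw [h3, show (4 * d).gcd r ≠ 1 ↔ ¬ (4 * d).Coprime r from Iff.rfl, Nat.coprime_comm, ← Nat.Prime.dvd_iff_not_coprime hr,
      hr4.dvd_mul_left]
    simp [hr, h2]

theorem isSplitPrime_of_isSquare {d r : ℕ} (hd4 : d % 4 = 3) (hr : r.Prime) (h2 : r ≠ 2)
    (hrd : ¬ r ∣ d) (hsq : IsSquare (d : ZMod r)) : IsSplitPrime d r := by
  have := Fact.mk hr
  refine ⟨hr, ?_⟩
  have h0 : kronecker (disc d) r ≠ 0 := fun h =>
    ((isRamifiedPrime_iff hd4 hr).1 ⟨hr, h⟩).elim h2 hrd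
  rw [kronecker_of_ne_two h2, disc_of_mod_four hd4] at h0 ⊢
  rcases jacobiSym.trichotomy (4 * d) r with h | h | h
  · exact absurd h h0
  · exact h
  · refine absurd ?_ (ZMod.nonsquare_of_jacobiSym_eq_neg_one h)
    obtain ⟨s, hs⟩ := hsq
    exact ⟨2 * s, by push_cast; rw [hs]; ring⟩

theorem not_isSplitPrime_of_isRamifiedPrime {d r : ℕ} (h : IsRamifiedPrime d r) :
    ¬ IsSplitPrime d r := fun h' => by
  have := h.2.symm.trans h'.2
  exact absurd this (by decide)

/-- A ramified prime `r` is an unusual conductor as soon as its class number and norm conditions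
hold. -/
theorem isUnusualConductor_of_prime {d r : ℕ} (hh : classNumber d = 2) (hr : IsRamifiedPrime d r)
    (hpic : picCard d r = 2)
    (hn : ∀ a b : ℤ, |(r : ℤ) * a ^ 2 - disc d / (r : ℤ) * b ^ 2| ≠ 4) :
    IsUnusualConductor d r where
  squarefree := hr.1.squarefree
  ramified := ⟨r, hr, dvd_rfl⟩
  not_split s hs hsr := by
    obtain rfl := (Nat.prime_dvd_prime_iff_eq hs.1 hr.1).1 hsr
    exact not_isSplitPrime_of_isRamifiedPrime hr hs
  classNumber_eq := by rw [hh, hpic]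
  picCard_eq := hpic
  norm_ne s hs hsr := by
    obtain rfl := (Nat.prime_dvd_prime_iff_eq hs.1 hr.1).1 hsr
    exact hn

section
variable {p q d : ℕ} {e : (ℤ√(d : ℤ))ˣ}

theorem _root_.Zsqrtd.IsAdmissible.squarefree (h : IsAdmissible p q d) : Squarefree d := by
  have hd : d = p * q := by exact_mod_cast h.eq_mul
  have hpq : p ≠ q := by
    rintro rfl; have := h.left_mod; have := h.right_mod; omega
  rw [hd, Nat.squarefree_mul ((Nat.coprime_primes h.prime_left h.prime_right).2 hpq)]
  exact ⟨h.prime_left.squarefree, h.prime_right.squarefree⟩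

/-- The parity of the coefficient of `√d` in the fundamental unit is a residue symbol. -/
theorem odd_im_iff_jacobiSym (h : IsAdmissible p q d) (he : IsFundamental e) (hp8 : p % 8 = 5) :
    Odd (e : ℤ√(d : ℤ)).im ↔ jacobiSym p q = -1 := by
  have hqo : Odd q := Nat.odd_iff.2 (by have := h.right_mod; omega)
  rw [jacobiSym.quadratic_reciprocity_one_mod_four h.left_mod hqo]
  have h2 := jacobiSym_two_of_mod_eight_eq_five hp8
  have h2' : jacobiSym (-2) p = -1 := by rw [jacobiSym_neg_left_of_mod_four h.left_mod, h2]
  -- Reduction mod `p` gives `-c ≡ qb²`, and the sign is harmless as `-1` is a residue mod `p`.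
  have key : ∀ a b c : ℤ, p * a ^ 2 - q * b ^ 2 = c → jacobiSym c p ≠ 0 →
      jacobiSym q p = jacobiSym c p := by
    intro a b c hc hc0
    rw [← jacobiSym_neg_left_of_mod_four h.left_mod c] at hc0 ⊢
    exact jacobiSym_eq_of_dvd_sub_mul_sq (b := b) ⟨-a ^ 2, by linear_combination hc⟩ hc0
  have hsq : ∀ a b c : ℤ, a ^ 2 - d * b ^ 2 = c → jacobiSym c p ≠ -1 := by
    intro a b c hc
    refine jacobiSym_ne_neg_one_of_dvd_sub_sq (b := a) ⟨-(q * b ^ 2), ?_⟩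
    linear_combination -hc - b ^ 2 * h.eq_mul
  constructor
  · intro hy
    obtain ⟨a, b, (hab | hab) | (hab | hab)⟩ := h.exists_of_odd_im he hy
    · exact absurd h2 (hsq a b _ hab)
    · exact absurd h2' (hsq a b _ hab)
    · rw [key a b _ hab (by rw [h2]; decide), h2]
    · rw [key a b _ hab (by rw [h2']; decide), h2']
  · intro hj
    by_contra hy
    have h1 : jacobiSym 1 p = 1 := jacobiSym.one_left p
    have h1' : jacobiSym (-1) p = 1 := by rw [jacobiSym_neg_left_of_mod_four h.left_mod, h1]
    obtain ⟨a, b, hab | hab⟩ := h.exists_of_even_im he (Int.not_odd_iff_even.1 hy)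
    · rw [key a b _ hab (by rw [h1]; decide), h1] at hj
      exact absurd hj (by decide)
    · rw [key a b _ hab (by rw [h1']; decide), h1'] at hj
      exact absurd hj (by decide)

theorem disc_div_two (h : IsAdmissible p q d) : disc d / ((2 : ℕ) : ℤ) = 2 * d := by
  have := h.mod_four
  rw [disc_of_mod_four (by omega)]
  omega

theorem norm_ne_two_iff (h : IsAdmissible p q d) (a b : ℤ) :
    |((2 : ℕ) : ℤ) * a ^ 2 - disc d / ((2 : ℕ) : ℤ) * b ^ 2| = 4 ↔
      a ^ 2 - d * b ^ 2 = 2 ∨ a ^ 2 - d * b ^ 2 = -2 := by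
  rw [disc_div_two h, abs_eq (by norm_num)]
  refine or_congr ⟨fun h => ?_, fun h => ?_⟩ ⟨fun h => ?_, fun h => ?_⟩ <;> push_cast at * <;> linarith

/-- In `ra² - 4sb² = ±4` with `r` odd, `a` must be even, and division by `4` gives the excluded
equation. -/
theorem norm_ne_of_odd_factor {r s : ℕ} (hr : r ≠ 0) (hro : Odd r) (hd : (d : ℤ) = r * s)
    (hd4 : d % 4 = 3) (hrs : ∀ a b : ℤ, ¬ (r * a ^ 2 - s * b ^ 2 = 1 ∨ r * a ^ 2 - s * b ^ 2 = -1))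
    (a b : ℤ) : |(r : ℤ) * a ^ 2 - disc d / (r : ℤ) * b ^ 2| ≠ 4 := by
  have hr0 : (r : ℤ) ≠ 0 := by exact_mod_cast hr
  have hdiv : disc d / (r : ℤ) = 4 * s := by
    rw [disc_of_mod_four hd4, hd]
    exact Int.ediv_eq_of_eq_mul_right hr0 (by ring)
  rw [hdiv]
  intro habs
  rw [abs_eq (by norm_num)] at habs
  have hra : Even ((r : ℤ) * a ^ 2) := by
    rcases habs with h | h
    · exact ⟨2 * (s * b ^ 2) + 2, by linarith⟩
    · exact ⟨2 * (s * b ^ 2) - 2, by linarith⟩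
  have ha : Even a := by
    rw [Int.even_mul, Int.even_pow] at hra
    rcases hra with h | h
    · exact absurd h (by rw [Int.not_even_iff_odd]; exact_mod_cast hro)
    · exact h.1
  obtain ⟨a', rfl⟩ := even_iff_exists_two_mul.1 ha
  refine hrs a' b ?_
  rcases habs with h | h
  · exact Or.inl (by linarith)
  · exact Or.inr (by linarith)

theorem not_dvd_of_isUnusualConductor (h : IsAdmissible p q d) (he : IsFundamental e) {f r : ℕ}
    (hf : IsUnusualConductor d f) (hr : r.Prime) (hrf : r ∣ f)
    {a : ℤ} (ha : ¬ (r : ℤ) ∣ a ^ 2 - d) : ¬ (r : ℤ) ∣ (e : ℤ√(d : ℤ)).im := by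
  have hd4 : d % 4 = 3 := by have := h.mod_four; omega
  exact h.not_dvd_im he hf.squarefree hr hrf
    ((picCard_eq_two_iff h.squarefree hd4 hf.squarefree.ne_zero).1 hf.picCard_eq) ha

/-- If every prime factor of `d` divides the coefficient of `√d` in the fundamental unit, the only
possible unusual conductor is `2`. -/
theorem eq_two_of_isUnusualConductor (h : IsAdmissible p q d) (he : IsFundamental e)
    (hdy : (d : ℤ) ∣ (e : ℤ√(d : ℤ)).im) {f : ℕ} (hf : IsUnusualConductor d f) : f = 2 := by
  have hd4 : d % 4 = 3 := by have := h.mod_four; omega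
  have hT := (picCard_eq_two_iff h.squarefree hd4 hf.squarefree.ne_zero).1
    hf.picCard_eq
  have hprime : ∀ r : ℕ, r.Prime → r ∣ f → r = 2 := by
    intro r hr hrf
    by_contra hr2
    by_cases hrd : r ∣ d
    -- An odd ramified `r` divides `e.im`, so units miss part of the local quotient; any other odd
    -- `r` would have to be split.
    · have hrd' : (r : ℤ) ∣ d := Int.natCast_dvd_natCast.2 hrd
      refine not_dvd_of_isUnusualConductor h he hf hr hrf (a := 1) ?_ (hrd'.trans hdy)
      rw [dvd_sub_left hrd', one_pow]
      exact fun h1 => (Nat.prime_iff_prime_int.1 hr).not_isUnit (isUnit_of_dvd_one h1)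
    · have hsq := h.isSquare_of_dvd hf.squarefree hr hrf hT
      exact hf.not_split r (isSplitPrime_of_isSquare hd4 hr hr2 hrd (by exact_mod_cast hsq)) hrf
  obtain ⟨r, hr, g, rfl⟩ := hf.ramified
  obtain rfl := hprime r hr.1 (dvd_mul_right _ _)
  by_cases hg : g = 1
  · rw [hg]
  · exfalso
    obtain ⟨s, hs, hsg⟩ := Nat.exists_prime_and_dvd hg
    obtain rfl := hprime s hs (hsg.mul_left _)
    exact hs.not_isUnit (hf.squarefree 2 (mul_dvd_mul_left _ hsg))

theorem isUnusualConductor_two (h : IsAdmissible p q d) (hh : classNumber d = 2)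
    (hp8 : p % 8 = 5) (hy : Odd (e : ℤ√(d : ℤ)).im) : IsUnusualConductor d 2 := by
  have hd4 : d % 4 = 3 := by have := h.mod_four; omega
  have hsf := h.squarefree
  refine isUnusualConductor_of_prime hh ((isRamifiedPrime_iff hd4 Nat.prime_two).2 (Or.inl rfl))
    ((picCard_eq_two_iff hsf hd4 two_ne_zero).2
      (h.twoClasses_two hy ((classNumber_eq_two_iff hsf hd4).1 hh))) ?_
  intro a b hab
  have hsq : ∀ c : ℤ, a ^ 2 - d * b ^ 2 = c → jacobiSym c p ≠ -1 := by
    intro c hc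
    refine jacobiSym_ne_neg_one_of_dvd_sub_sq (b := a) ⟨-(q * b ^ 2), ?_⟩
    linear_combination -hc - b ^ 2 * h.eq_mul
  have h2 := jacobiSym_two_of_mod_eight_eq_five hp8
  rcases (norm_ne_two_iff h a b).1 hab with h3 | h3
  · exact hsq _ h3 h2
  · exact hsq _ h3 (by rw [jacobiSym_neg_left_of_mod_four h.left_mod, h2])

theorem of_unusualConductors_eq (h : IsAdmissible p q d) (he : IsFundamental e)
    (hh : classNumber d = 2) (hD : unusualConductors d = {2}) :
    p % 8 = 5 ∧ Odd (e : ℤ√(d : ℤ)).im ∧ (d : ℤ) ∣ (e : ℤ√(d : ℤ)).im := by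
  have hd4 : d % 4 = 3 := by have := h.mod_four; omega
  have hsf := h.squarefree
  have hS := (classNumber_eq_two_iff hsf hd4).1 hh
  have h2 : IsUnusualConductor d 2 := by
    have : 2 ∈ unusualConductors d := hD ▸ Set.mem_singleton 2
    exact this
  have hram2 := (isRamifiedPrime_iff hd4 Nat.prime_two).2 (Or.inl rfl)
  have hy : Odd (e : ℤ√(d : ℤ)).im := by
    have h3 := not_dvd_of_isUnusualConductor h he h2 Nat.prime_two dvd_rfl (a := 0) (by omega)
    rw [← Int.not_even_iff_odd, even_iff_two_dvd]
    exact h3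
  have hp8 : p % 8 = 5 := by
    by_contra hp8
    have hp1 : p % 8 = 1 := by have := h.left_mod; omega
    obtain ⟨γ, hγ⟩ := h.exists_norm_eq_two hS hp1
    refine h2.norm_ne 2 hram2 dvd_rfl γ.re γ.im ((norm_ne_two_iff h _ _).2 ?_)
    have h4 : γ.norm = γ.re ^ 2 - d * γ.im ^ 2 := by rw [norm_def]; ring
    rw [← h4]
    omega
  -- An odd prime `r ∣ d` not dividing `e.im` would itself be a second unusual conductor.
  have hdvd : ∀ r : ℕ, r.Prime → r ≠ 2 → r ∣ d →
      (∀ a b : ℤ, |(r : ℤ) * a ^ 2 - disc d / (r : ℤ) * b ^ 2| ≠ 4) →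
      (r : ℤ) ∣ (e : ℤ√(d : ℤ)).im := by
    intro r hr hr2 hrd hn
    by_contra hre
    have hmem : r ∈ unusualConductors d := isUnusualConductor_of_prime hh
      ((isRamifiedPrime_iff hd4 hr).2 (Or.inr hrd)) ((picCard_eq_two_iff hsf hd4 hr.ne_zero).2
        (h.twoClasses_of_dvd hr (Int.natCast_dvd_natCast.2 hrd) hre hS)) hn
    rw [hD] at hmem
    exact hr2 hmem
  have hpo : Odd p := Nat.odd_iff.2 (by omega)
  have hqo : Odd q := Nat.odd_iff.2 (by have := h.right_mod; omega)
  have hd : d = p * q := by exact_mod_cast h.eq_mul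
  have hne := h.ne_of_odd_im he hy
  refine ⟨hp8, hy, ?_⟩
  have hpq : p ≠ q := by
    rintro rfl; have := h.right_mod; omega
  refine h.eq_mul.dvd.trans (IsCoprime.mul_dvd (Nat.isCoprime_iff_coprime.2
    ((Nat.coprime_primes h.prime_left h.prime_right).2 hpq)) ?_ ?_)
  · exact hdvd p h.prime_left (by rintro rfl; omega) ⟨q, hd⟩
      (norm_ne_of_odd_factor h.prime_left.ne_zero hpo h.eq_mul hd4 hne)
  · refine hdvd q h.prime_right (by rintro rfl; exact absurd hqo (by decide))
      ⟨p, by rw [hd, mul_comm]⟩ (norm_ne_of_odd_factor h.prime_right.ne_zero hqo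
        (h.eq_mul.trans (mul_comm _ _)) hd4 fun a b hab => hne b a ?_)
    rcases hab with h3 | h3
    · exact Or.inr (by linarith)
    · exact Or.inl (by linarith)

end

end UnusualOrders

theorem proposition2p4 (p q d : ℕ) (hp : p.Prime) (hq : q.Prime)
    (hp4 : p ≡ 1 [MOD 4]) (hq4 : q ≡ 3 [MOD 4]) (hd : d = p * q)
    (hh : UnusualOrders.classNumber d = 2)
    (ε : (UnusualOrders.MaxOrder d)ˣ) (hε : UnusualOrders.IsFundamentalUnit d ε)
    (x y : ℕ)
    (hxy : UnusualOrders.toReal (ε : UnusualOrders.MaxOrder d) =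
      (x : ℝ) + (y : ℝ) * UnusualOrders.omega d) :
    List.TFAE [
      UnusualOrders.unusualConductors d = {2},
      p ≡ 5 [MOD 8] ∧ Odd y ∧ d ∣ y,
      p ≡ 5 [MOD 8] ∧ UnusualOrders.kronecker (p : ℤ) q = -1 ∧ d ∣ y] := by
  have h : Zsqrtd.IsAdmissible p q d := ⟨hp, hq, hp4, hq4, by rw [hd]; push_cast; rfl⟩
  have hd4 : d % 4 = 3 := by have := h.mod_four; omega
  obtain ⟨e, he, hey⟩ :=
    UnusualOrders.exists_isFundamental h.squarefree hd4 hε hxy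
  have hodd : Odd (e : ℤ√(d : ℤ)).im ↔ Odd y := by rw [hey]; exact_mod_cast Iff.rfl
  have hdvd : (d : ℤ) ∣ (e : ℤ√(d : ℤ)).im ↔ d ∣ y := by rw [hey, Int.natCast_dvd_natCast]
  have hkr : UnusualOrders.kronecker (p : ℤ) q = jacobiSym p q :=
    UnusualOrders.kronecker_of_ne_two (by rintro rfl; exact absurd hq4 (by decide))
  tfae_have 1 → 2 := by
    intro hD
    obtain ⟨h1, h2, h3⟩ := UnusualOrders.of_unusualConductors_eq h he hh hD
    exact ⟨h1, hodd.1 h2, hdvd.1 h3⟩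
  tfae_have 2 → 1 := by
    rintro ⟨h1, h2, h3⟩
    ext f
    rw [Set.mem_singleton_iff]
    constructor
    · exact fun hf => UnusualOrders.eq_two_of_isUnusualConductor h he (hdvd.2 h3) hf
    · rintro rfl
      exact UnusualOrders.isUnusualConductor_two h hh h1 (hodd.2 h2)
  tfae_have 2 ↔ 3 := by
    rw [hkr]
    refine and_congr_right fun h1 => and_congr_left fun _ => ?_
    rw [← hodd, UnusualOrders.odd_im_iff_jacobiSym h he h1]
  tfae_finish
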